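/- Let $G=(V,E)$ be a finite directed multigraph with source $s$ and sink $t\neq s$, capacities $\nu_e>0$, transit times $\tau_e\ge 0$ such that every directed cycle has positive total transit time, and constant network inflow rate $u_0>0$. For a labelling $\ell\in\mathbb R^V$ let $E'_\ell=\{vw\in E:\ell_w\ge \ell_v+\tau_{vw}\}$ (active arcs) and $E^*_\ell=\{vw\in E:\ell_w> \ell_v+\tau_{vw}\}$ (resetting arcs). Let $\Omega\subseteq\mathbb R^V$ be the set of feasible labellings, i.e. those $\ell$ for which every vertex is reachable from $s$ within $E'_\ell$ and every arc of $E^*_\ell$ lies on an $s$-$t$-path within $E'_\ell$. A thin flow for $(E',E^*)$ is a pair $(x',\ell')\in\mathbb R_{\ge0}^E\times\mathbb R^V$ such that $x'$ is an $s$-$t$-flow of value $u_0$ vanishing outside $E'$, $\ell'_s=1$, $\ell'_w=\min_{e=vw\in E'}\rho_e(\ell'_v,x'_e)$ for all $w\ne s$, and $\ell'_w=\rho_e(\ell'_v,x'_e)$ for all $e=vw\in E'$ with $x'_e>0$, where $\rho_e(a,y)=y/\nu_e$ if $e\in E^*$ and $\rho_e(a,y)=\max\{a,y/\nu_e\}$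 otherwise. An equilibrium trajectory is a locally absolutely continuous function $\ell:\mathbb R_{\ge0}\to\Omega$ such that for almost every $\theta$ the derivative $\ell'(\theta)$ exists and is the label vector of a thin flow for $(E'_{\ell(\theta)},E^*_{\ell(\theta)})$. Then for every $\ell^\circ\in\Omega$ there is exactly one equilibrium trajectory $\Psi(\ell^\circ)=\ell$ with $\ell(0)=\ell^\circ$. All the trajectories $\Psi(\ell^\circ)$, $\ell^\circ\in\Omega$, are Lipschitz continuous with a common constant. For every $\xi\ge0$ the map $\Psi_\xi:\Omega\to\mathbb R^V$, $\ell^\circ\mapsto\Psi(\ell^\circ)(\xi)$, is continuous, and $\Psi$ is continuous in the sup norm: for every $\ell^\circ\in\Omega$ and $\varepsilon>0$ there is $\delta>0$ such that $\sup_{\theta\ge0}\|\Psi(\ell^\circ)(\theta)-\Psi(\hat\ell^\circ)(\theta)\|\le\varepsilon$ for all $\hat\ell^\circ\in\Omega$ with $\|\hat\ell^\circ-\ell^\circ\|<\delta$. -/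

import Mathlib

open scoped NNReal

/-- A single-source single-sink network on a finite directed multigraph with vertex type `V` and
arc type `E`: arc capacities `ν`, transit times `τ`, constant network inflow rate `u₀`. -/
structure FlowNetwork (V E : Type*) [Fintype V] [Fintype E] where
  /-- tail of an arc -/
  src : E → V
  /-- head of an arc -/
  tgt : E → V
  /-- source -/
  s : V
  /-- sink -/
  t : V
  /-- capacities -/
  ν : E → ℝ
  /-- transit times -/
  τ : E → ℝ
  /-- network inflow rate -/
  u₀ : ℝ
  s_ne_t : s ≠ t
  ν_pos : ∀ e, 0 < ν e
  τ_nonneg : ∀ e, 0 ≤ τ e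
  u₀_pos : 0 < u₀
  /-- Every directed cycle has positive total transit time (the successor `i + 1` in `Fin (n + 1)`
  is cyclic). -/
  cycle_pos : ∀ (n : ℕ) (c : Fin (n + 1) → E),
    (∀ i, tgt (c i) = src (c (i + 1))) → 0 < ∑ i, τ (c i)

namespace FlowNetwork

/-- The arcs `vw` that are active for the labelling `l`: `l_w ≥ l_v + τ_{vw}`. -/
def activeArcs {V E : Type*} [Fintype V] [Fintype E] (N : FlowNetwork V E) (l : V → ℝ) : Set E :=
  {e | l (N.src e) + N.τ e ≤ l (N.tgt e)}

/-- The arcs `vw` that are resetting for `l`, that is, have a queue: `l_w > l_v + τ_{vw}`. -/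
def resettingArcs {V E : Type*} [Fintype V] [Fintype E] (N : FlowNetwork V E) (l : V → ℝ) :
    Set E :=
  {e | l (N.src e) + N.τ e < l (N.tgt e)}

/-- `N.Reachable A v w`: there is a directed path from `v` to `w` using only arcs of `A`. -/
def Reachable {V E : Type*} [Fintype V] [Fintype E] (N : FlowNetwork V E) (A : Set E) :
    V → V → Prop :=
  Relation.ReflTransGen fun a b => ∃ e ∈ A, N.src e = a ∧ N.tgt e = b

/-- The set `Ω` of feasible labellings (initial conditions): every vertex is reachable from the
source by active arcs, and every resetting arc lies on an active path from source to sink. -/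
def feasibleLabellings {V E : Type*} [Fintype V] [Fintype E] (N : FlowNetwork V E) :
    Set (V → ℝ) :=
  {l | (∀ v, N.Reachable (N.activeArcs l) N.s v) ∧
    ∀ e ∈ N.resettingArcs l,
      N.Reachable (N.activeArcs l) N.s (N.src e) ∧ N.Reachable (N.activeArcs l) (N.tgt e) N.t}

/-- `x` is a static flow from source to sink of value `u₀`. -/
def IsStaticFlow {V E : Type*} [Fintype V] [DecidableEq V] [Fintype E] (N : FlowNetwork V E)
    (x : E → ℝ) : Prop :=
  (∀ e, 0 ≤ x e) ∧
    ∀ v, (∑ e with N.src e = v, x e) - (∑ e with N.tgt e = v, x e) =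
      if v = N.s then N.u₀ else if v = N.t then -N.u₀ else 0

open Classical in
/-- For an arc `e` whose tail has label derivative `a`, and which carries `y` units of flow: the
label derivative that `e` offers to its head, `y / ν_e` if `e` is in the resetting set `R`, and
`max (a, y / ν_e)` otherwise. -/
noncomputable def rho {V E : Type*} [Fintype V] [Fintype E] (N : FlowNetwork V E) (R : Set E)
    (e : E) (a y : ℝ) : ℝ :=
  if e ∈ R then y / N.ν e else max a (y / N.ν e)

/-- `(x, lam)` is a thin flow with resetting for the configuration with active arcs `A` and
resetting arcs `R`. -/
structure IsThinFlow {V E : Type*} [Fintype V] [DecidableEq V] [Fintype E] (N : FlowNetwork V E)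
    (A R : Set E) (x : E → ℝ) (lam : V → ℝ) : Prop where
  flow : N.IsStaticFlow x
  support : ∀ e, e ∉ A → x e = 0
  source : lam N.s = 1
  least : ∀ w, w ≠ N.s →
    IsLeast {r | ∃ e ∈ A, N.tgt e = w ∧ r = N.rho R e (lam (N.src e)) (x e)} (lam w)
  carrying : ∀ e ∈ A, 0 < x e → lam (N.tgt e) = N.rho R e (lam (N.src e)) (x e)

/-- Equilibrium trajectories: locally absolutely continuous curves of feasible labellings whose
derivative at almost every time is the label vector of a thin flow for the current configuration.
(The precomposition with `Real.toNNReal` only serves to differentiate a function of a time in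
`ℝ≥0` at positive times.) -/
structure IsEquilibriumTrajectory {V E : Type*} [Fintype V] [DecidableEq V] [Fintype E]
    (N : FlowNetwork V E) (l : ℝ≥0 → V → ℝ) : Prop where
  feasible : ∀ θ, l θ ∈ N.feasibleLabellings
  absCont : ∀ T : ℝ≥0, AbsolutelyContinuousOnInterval (fun θ : ℝ => l θ.toNNReal) 0 T
  thinFlow : ∀ᵐ θ : ℝ ∂MeasureTheory.volume.restrict (Set.Ioi 0),
    ∃ (x : E → ℝ) (lam : V → ℝ),
      N.IsThinFlow (N.activeArcs (l θ.toNNReal)) (N.resettingArcs (l θ.toNNReal)) x lam ∧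
      HasDerivAt (fun ξ : ℝ => l ξ.toNNReal) lam θ

end FlowNetwork

/-! Uniqueness and continuity rest on a Lyapunov function. Let `(y, lam)` solve the thin flow
conditions for `(P, Q)`, let `q_e` be the slack `l_w - l_v - τ_e`, and put `Ξ(l) = ∑ α_e min(q_e, 0)
- β_e max(q_e, 0)`, where `α_e`, `β_e` are built from `y_e / lam_w` and `ν_e - y_e / lam_w`. Then `Ξ
≤ 0`, with equality at labellings of configuration `(P, Q)`. Along a trajectory with active arcs
inside `P` and resetting arcs containing `Q`, which holds near such a labelling, `Ξ` grows at rate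
at least `c ‖mu - lam‖`, where `mu` is the current derivative (`exists_lyapunov`). So the total
deviation from direction `lam` is at most a constant times the initial distance
(`exists_local_estimate`). A trajectory starting exactly at the labelling is therefore linear for a
while, and nearby ones stay close to it; induction along the time axis carries this to compact
intervals.

The basic rate is nonnegative because flow conservation, tested with `r = mu / lam` and `r - log r`,
turns it into slack terms and terms `a - 1 - log a` (`lyapunovRate_eq`). If it vanishes, then `lam ≤
mu`, and extra weights on the arcs of a spanning tree detect any remaining difference. Only finitely
many derivatives occur, so a lexicographic choice of weights gives a uniform `c`.

Thin flows exist as limits of maximal subsolutions of a regularized system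
(`exists_isComplementary`). Moving along a thin flow gives a short linear trajectory; the common
speed bound and the closedness of the feasible set allow continuation.

For all times at once, take `P` to be all arcs and `Q` empty. The growth estimate is then global and
forces every trajectory into a steady state (`exists_steady_time`), from which the local estimate
remains valid forever. -/

namespace FlowNetwork

/-! ### Acyclicity of the active arcs and flow conservation tested against potentials -/

section Basics

variable {V E : Type*} [Fintype V] [Fintype E] (N : FlowNetwork V E)

/-- The relation "there is an arc of `A` from `a` to `b`". -/
def Adj (A : Set E) (a b : V) : Prop := ∃ e ∈ A, N.src e = a ∧ N.tgt e = b

theorem exists_chain_of_transGen {A : Set E} {a b : V} (h : Relation.TransGen (N.Adj A) a b) :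
    ∃ (n : ℕ) (c : Fin (n + 1) → E), N.src (c 0) = a ∧ N.tgt (c (Fin.last n)) = b ∧
      (∀ i : Fin n, N.tgt (c i.castSucc) = N.src (c i.succ)) ∧ ∀ i, c i ∈ A := by
  induction h using Relation.TransGen.head_induction_on with
  | single h =>
    obtain ⟨e, he, h1, h2⟩ := h
    exact ⟨0, fun _ => e, h1, h2, fun i => i.elim0, fun _ => he⟩
  | head h _ ih =>
    obtain ⟨e, he, h1, h2⟩ := h
    obtain ⟨n, c, hc0, hcl, hc, hA⟩ := ih
    refine ⟨n + 1, Fin.cons e c, by simpa using h1, ?_, ?_, ?_⟩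
    · rw [← Fin.succ_last, Fin.cons_succ]
      exact hcl
    · intro i
      refine Fin.cases ?_ (fun j => ?_) i
      · simp [h2, hc0]
      · rw [← Fin.succ_castSucc, Fin.cons_succ, Fin.cons_succ]
        exact hc j
    · intro i
      refine Fin.cases ?_ (fun j => ?_) i
      · simpa using he
      · simpa using hA j

/-- Around an active cycle the label differences dominate the transit times and telescope to zero,
against the positive transit time of the cycle. -/
theorem not_transGen_activeArcs (l : V → ℝ) (v : V) :
    ¬ Relation.TransGen (N.Adj (N.activeArcs l)) v v := by
  intro h
  obtain ⟨n, c, hc0, hcl, hc, hA⟩ := N.exists_chain_of_transGen h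
  have hcyc : ∀ i, N.tgt (c i) = N.src (c (i + 1)) := by
    intro i
    refine Fin.lastCases ?_ (fun j => ?_) i
    · rw [Fin.last_add_one, hc0, hcl]
    · rw [Fin.coeSucc_eq_succ]
      exact hc j
  have h1 := N.cycle_pos n c hcyc
  have h2 : ∑ i, N.τ (c i) ≤ ∑ i, (l (N.src (c (i + 1))) - l (N.src (c i))) := by
    refine Finset.sum_le_sum fun i _ => ?_
    have := hA i
    simp only [activeArcs, Set.mem_ofPred_eq, hcyc i] at this
    linarith
  have h3 : ∑ i, l (N.src (c (i + 1))) = ∑ i, l (N.src (c i)) :=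
    Equiv.sum_comp (Equiv.addRight (1 : Fin (n + 1))) (fun i => l (N.src (c i)))
  rw [Finset.sum_sub_distrib, h3] at h2
  linarith

theorem wellFounded_activeArcs (l : V → ℝ) : WellFounded (N.Adj (N.activeArcs l)) := by
  have : Std.Irrefl (Relation.TransGen (N.Adj (N.activeArcs l))) :=
    ⟨N.not_transGen_activeArcs l⟩
  exact Subrelation.wf (Relation.TransGen.single)
    (Finite.wellFounded_of_trans_of_irrefl (Relation.TransGen (N.Adj (N.activeArcs l))))

theorem resettingArcs_subset (l : V → ℝ) : N.resettingArcs l ⊆ N.activeArcs l :=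
  fun _ he => le_of_lt (Set.mem_ofPred_eq ▸ he)

variable [DecidableEq V] {N}

variable (N) in
theorem sum_mul_outflow_sub_inflow (x : E → ℝ) (f : V → ℝ) :
    ∑ v, f v * ((∑ e with N.src e = v, x e) - (∑ e with N.tgt e = v, x e)) =
      ∑ e, x e * (f (N.src e) - f (N.tgt e)) := by
  simp only [mul_sub, Finset.sum_sub_distrib, Finset.mul_sum]
  congr 1
  · rw [← Finset.sum_fiberwise (s := Finset.univ) (g := N.src)]
    refine Finset.sum_congr rfl fun v _ => Finset.sum_congr rfl fun e he => ?_
    rw [(Finset.mem_filter.1 he).2, mul_comm]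
  · rw [← Finset.sum_fiberwise (s := Finset.univ) (g := N.tgt)]
    refine Finset.sum_congr rfl fun v _ => Finset.sum_congr rfl fun e he => ?_
    rw [(Finset.mem_filter.1 he).2, mul_comm]

/-- Summation by parts. All uses of conservation on whole vertex sets go through this identity, with
a suitable potential `f`. -/
theorem IsStaticFlow.sum_mul_sub {x : E → ℝ} (hx : N.IsStaticFlow x) (f : V → ℝ) :
    ∑ e, x e * (f (N.tgt e) - f (N.src e)) = N.u₀ * (f N.t - f N.s) := by
  have h1 := N.sum_mul_outflow_sub_inflow x f
  have h2 : ∑ v, f v * (if v = N.s then N.u₀ else if v = N.t then -N.u₀ else 0) =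
      f N.s * N.u₀ - f N.t * N.u₀ := by
    have : ∀ v, f v * (if v = N.s then N.u₀ else if v = N.t then -N.u₀ else 0) =
        (if v = N.s then f v * N.u₀ else 0) + (if v = N.t then -(f v * N.u₀) else 0) := by
      intro v
      have := N.s_ne_t
      by_cases h : v = N.s
      · simp [h, this]
      · simp [h]
    simp only [this, Finset.sum_add_distrib]
    simp
    ring
  rw [Finset.sum_congr rfl fun v _ => by rw [hx.2 v], h2] at h1
  have h3 : ∑ e, x e * (f (N.tgt e) - f (N.src e)) =
      -∑ e, x e * (f (N.src e) - f (N.tgt e)) := by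
    rw [← Finset.sum_neg_distrib]
    exact Finset.sum_congr rfl fun e _ => by ring
  rw [h3, ← h1]
  ring

end Basics

/-! ### Thin flows as a complementarity system -/

section Complementary

variable {V E : Type*} [Fintype V] [Fintype E] (N : FlowNetwork V E)

/-- The arcs of `A` through which the label derivatives `lam` can be determined. -/
def supportArcs (A R : Set E) (lam : V → ℝ) : Set E :=
  {e | e ∈ A ∧ (e ∈ R ∨ lam (N.src e) ≤ lam (N.tgt e))}

/-- A reformulation of thin flows as a complementarity system, meaningful for cyclic `A`, too. -/
structure IsComplementary [DecidableEq V] (A R : Set E) (x : E → ℝ) (lam : V → ℝ) : Prop where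
  flow : N.IsStaticFlow x
  support : ∀ e, e ∉ A → x e = 0
  source : lam N.s = 1
  nonneg : ∀ v, 0 ≤ lam v
  reset : ∀ e ∈ R, x e = N.ν e * lam (N.tgt e)
  le : ∀ e, x e ≤ N.ν e * lam (N.tgt e)
  up : ∀ e ∈ A, lam (N.src e) < lam (N.tgt e) → x e = N.ν e * lam (N.tgt e)
  down : ∀ e ∉ R, lam (N.tgt e) < lam (N.src e) → x e = 0
  grounded : ∀ v, N.Reachable (N.supportArcs A R lam) N.s v

/-- The properties of the configuration of a feasible labelling. -/
structure IsFeasibleConfig (A R : Set E) : Prop where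
  subset : R ⊆ A
  wf : WellFounded (N.Adj A)
  reachable : ∀ v, N.Reachable A N.s v
  reset : ∀ e ∈ R, N.Reachable A (N.tgt e) N.t

variable {N}

theorem isFeasibleConfig_of_mem {l : V → ℝ} (hl : l ∈ N.feasibleLabellings) :
    N.IsFeasibleConfig (N.activeArcs l) (N.resettingArcs l) :=
  ⟨N.resettingArcs_subset l, N.wellFounded_activeArcs l, hl.1, fun e he => (hl.2 e he).2⟩

variable [DecidableEq V] {A R : Set E} {x : E → ℝ} {lam : V → ℝ}

theorem IsStaticFlow.exists_pos_of_pos_out (hx : N.IsStaticFlow x) {e : E} (he : 0 < x e)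
    (hs : N.src e ≠ N.s) : ∃ e', N.tgt e' = N.src e ∧ 0 < x e' := by
  by_contra! hcon
  have h1 : ∑ e' with N.tgt e' = N.src e, x e' ≤ 0 :=
    Finset.sum_nonpos fun e' he' => hcon e' (Finset.mem_filter.1 he').2
  have h2 : x e ≤ ∑ e' with N.src e' = N.src e, x e' :=
    Finset.single_le_sum (fun e' _ => hx.1 e') (by simp)
  have h3 := hx.2 (N.src e)
  rw [if_neg hs] at h3
  have := N.u₀_pos
  split_ifs at h3 <;> linarith

theorem IsStaticFlow.exists_pos_of_pos_in (hx : N.IsStaticFlow x) {e : E} (he : 0 < x e)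
    (hs : N.tgt e ≠ N.t) : ∃ e', N.src e' = N.tgt e ∧ 0 < x e' := by
  by_contra! hcon
  have h1 : ∑ e' with N.src e' = N.tgt e, x e' ≤ 0 :=
    Finset.sum_nonpos fun e' he' => hcon e' (Finset.mem_filter.1 he').2
  have h2 : x e ≤ ∑ e' with N.tgt e' = N.tgt e, x e' :=
    Finset.single_le_sum (fun e' _ => hx.1 e') (by simp)
  have h3 := hx.2 (N.tgt e)
  rw [if_neg hs] at h3
  have := N.u₀_pos
  split_ifs at h3 <;> linarith

theorem IsStaticFlow.exists_pos_sink (hx : N.IsStaticFlow x) : ∃ e, N.tgt e = N.t ∧ 0 < x e := by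
  by_contra! hcon
  have h1 : ∑ e with N.tgt e = N.t, x e ≤ 0 :=
    Finset.sum_nonpos fun e' he' => hcon e' (Finset.mem_filter.1 he').2
  have h2 : 0 ≤ ∑ e with N.src e = N.t, x e := Finset.sum_nonneg fun e _ => hx.1 e
  have h3 := hx.2 N.t
  rw [if_neg N.s_ne_t.symm, if_pos rfl] at h3
  have := N.u₀_pos
  linarith

/-- Walk back from the sink, whose label is positive because flow enters it. An arc from label zero
to a positive label would carry flow, so flow would also enter its tail, but the tail's label bounds
that inflow by zero. Only positivity is asked in `hup`, so that the regularized flows qualify too.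
-/
theorem IsStaticFlow.pos_of_reachable_sink (hx : N.IsStaticFlow x) (hs : lam N.s = 1)
    (hnonneg : ∀ v, 0 ≤ lam v) (hle : ∀ e, x e ≤ N.ν e * lam (N.tgt e))
    (hup : ∀ e ∈ A, lam (N.src e) < lam (N.tgt e) → 0 < x e)
    {w : V} (hw : N.Reachable A w N.t) : 0 < lam w := by
  induction hw using Relation.ReflTransGen.head_induction_on with
  | refl =>
    obtain ⟨e, he, hpos⟩ := hx.exists_pos_sink
    have := hle e
    rw [he] at this
    exact pos_of_mul_pos_right (hpos.trans_le this) (N.ν_pos e).le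
  | head hab _ ih =>
    obtain ⟨e, heA, rfl, rfl⟩ := hab
    by_contra hcon
    have hpos := hup e heA (lt_of_le_of_lt (not_lt.1 hcon) ih)
    have h0 : lam (N.src e) = 0 := le_antisymm (not_lt.1 hcon) (hnonneg _)
    have hs : N.src e ≠ N.s := by
      intro hs'
      rw [hs', hs] at h0
      exact one_ne_zero h0
    obtain ⟨e', he', hpos'⟩ := hx.exists_pos_of_pos_out hpos hs
    have := hle e'
    rw [he', h0, mul_zero] at this
    linarith

/-- Along a grounding path, a nonresetting arc does not decrease the label, and the head of a
resetting arc is positive because it reaches the sink. -/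
theorem IsComplementary.pos (h : N.IsComplementary A R x lam)
    (hR : ∀ e ∈ R, N.Reachable A (N.tgt e) N.t) (v : V) : 0 < lam v := by
  induction h.grounded v with
  | refl => rw [h.source]; exact one_pos
  | tail _ hbc ih =>
    obtain ⟨e, ⟨heA, he⟩, rfl, rfl⟩ := hbc
    rcases he with he | he
    · refine h.flow.pos_of_reachable_sink h.source h.nonneg h.le (fun e he hlt => ?_) (hR e he)
      rw [h.up e he hlt]
      exact mul_pos (N.ν_pos e) ((h.nonneg _).trans_lt hlt)
    · exact ih.trans_le he

theorem reachable_of_forall_exists {B : Set E} (hwf : WellFounded (N.Adj B))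
    (h : ∀ w, w ≠ N.s → ∃ e ∈ B, N.tgt e = w) (v : V) : N.Reachable B N.s v := by
  induction v using hwf.induction with
  | _ w ih =>
    by_cases hw : w = N.s
    · rw [hw]; exact Relation.ReflTransGen.refl
    · obtain ⟨e, he, rfl⟩ := h w hw
      exact (ih _ ⟨e, he, rfl, rfl⟩).tail ⟨e, he, rfl, rfl⟩

theorem IsThinFlow.isComplementary (hA : N.IsFeasibleConfig A R)
    (h : N.IsThinFlow A R x lam) : N.IsComplementary A R x lam := by
  have hdiv : ∀ e, 0 ≤ x e / N.ν e := fun e => div_nonneg (h.flow.1 e) (N.ν_pos e).le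
  have hrho : ∀ e a, 0 ≤ N.rho R e a (x e) := by
    intro e a
    unfold rho
    split_ifs
    · exact hdiv e
    · exact le_max_of_le_right (hdiv e)
  have hnonneg : ∀ v, 0 ≤ lam v := by
    intro v
    by_cases hv : v = N.s
    · rw [hv, h.source]; exact zero_le_one
    · obtain ⟨e, -, -, he⟩ := (h.least v hv).1
      rw [he]
      exact hrho _ _
  -- The thin flow conditions impose no minimum at the source, while the complementarity system
  -- constrains every arc. An arc of `A` into the source would close a cycle, since the source
  -- reaches everything.
  have htgt : ∀ e ∈ A, N.tgt e ≠ N.s := by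
    intro e he hs
    have h1 : Relation.TransGen (N.Adj A) (N.tgt e) (N.tgt e) := by
      refine Relation.TransGen.tail' (b := N.src e) ?_ ⟨e, he, rfl, rfl⟩
      rw [hs]
      exact hA.reachable _
    exact (hA.wf.transGen.irrefl).irrefl _ h1
  have hle : ∀ e ∈ A, lam (N.tgt e) ≤ N.rho R e (lam (N.src e)) (x e) := fun e he =>
    (h.least _ (htgt e he)).2 ⟨e, he, rfl, rfl⟩
  have hxle : ∀ e, x e ≤ N.ν e * lam (N.tgt e) := by
    intro e
    rcases (h.flow.1 e).eq_or_lt with h0 | h0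
    · rw [← h0]; exact mul_nonneg (N.ν_pos e).le (hnonneg _)
    · have heA : e ∈ A := by
        by_contra hcon
        exact h0.ne' (h.support e hcon)
      rw [h.carrying e heA h0, ← div_le_iff₀' (N.ν_pos e)]
      unfold rho
      split_ifs
      · exact le_rfl
      · exact le_max_right _ _
  refine ⟨h.flow, h.support, h.source, hnonneg, ?_, hxle, ?_, ?_, ?_⟩
  · intro e he
    refine le_antisymm (hxle e) ?_
    have := hle e (hA.subset he)
    rwa [rho, if_pos he, le_div_iff₀' (N.ν_pos e)] at this
  · intro e he hlt
    refine le_antisymm (hxle e) ?_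
    have := hle e he
    rw [← le_div_iff₀' (N.ν_pos e)]
    unfold rho at this
    split_ifs at this
    · exact this
    · rcases le_max_iff.1 this with h1 | h1
      · exact absurd h1 (not_le.2 hlt)
      · exact h1
  · intro e he hlt
    by_contra hne
    have h0 : 0 < x e := lt_of_le_of_ne (h.flow.1 e) (Ne.symm hne)
    have heA : e ∈ A := by
      by_contra hcon
      exact hne (h.support e hcon)
    have := h.carrying e heA h0
    rw [rho, if_neg he] at this
    have h2 := le_max_left (lam (N.src e)) (x e / N.ν e)
    linarith
  · refine reachable_of_forall_exists (Subrelation.wf ?_ hA.wf) ?_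
    · rintro a b ⟨e, he, h1⟩
      exact ⟨e, he.1, h1⟩
    · intro w hw
      obtain ⟨e, heA, rfl, he⟩ := (h.least w hw).1
      refine ⟨e, ⟨heA, ?_⟩, rfl⟩
      by_cases heR : e ∈ R
      · exact Or.inl heR
      · right
        rw [he, rho, if_neg heR]
        exact le_max_left _ _

/-- The last arc of a grounding path attains the minimum at its head; acyclicity is not needed in
this direction. -/
theorem IsComplementary.isThinFlow (h : N.IsComplementary A R x lam) :
    N.IsThinFlow A R x lam := by
  have hle : ∀ e ∈ A, lam (N.tgt e) ≤ N.rho R e (lam (N.src e)) (x e) := by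
    intro e he
    unfold rho
    split_ifs with hR
    · rw [h.reset e hR, mul_div_cancel_left₀ _ (N.ν_pos e).ne']
    · by_cases hlt : lam (N.src e) < lam (N.tgt e)
      · refine le_max_of_le_right ?_
        rw [h.up e he hlt, mul_div_cancel_left₀ _ (N.ν_pos e).ne']
      · exact le_max_of_le_left (not_lt.1 hlt)
  have hge : ∀ e, (e ∈ R ∨ lam (N.src e) ≤ lam (N.tgt e)) →
      N.rho R e (lam (N.src e)) (x e) ≤ lam (N.tgt e) := by
    intro e he
    have h1 : x e / N.ν e ≤ lam (N.tgt e) := by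
      rw [div_le_iff₀' (N.ν_pos e)]
      exact h.le e
    unfold rho
    split_ifs with hR
    · exact h1
    · exact max_le (he.resolve_left hR) h1
  refine ⟨h.flow, h.support, h.source, ?_, ?_⟩
  · intro w hw
    refine ⟨?_, ?_⟩
    · rcases Relation.ReflTransGen.cases_tail (h.grounded w) with h1 | ⟨c, -, e, he, -, rfl⟩
      · exact absurd h1 hw
      · exact ⟨e, he.1, rfl, le_antisymm (hle e he.1) (hge e he.2)⟩
    · rintro r ⟨e, he, rfl, rfl⟩
      exact hle e he
  · intro e he hpos
    refine le_antisymm (hle e he) (hge e ?_)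
    by_contra! hcon
    exact hpos.ne' (h.down e hcon.1 hcon.2)

theorem IsThinFlow.pos (hA : N.IsFeasibleConfig A R) (h : N.IsThinFlow A R x lam) (v : V) :
    0 < lam v :=
  (h.isComplementary hA).pos hA.reset v

end Complementary

end FlowNetwork

namespace FlowNetwork

/-! ### Depth functions and finite choices of constants -/

section Combinatorics

theorem exists_depth {V : Type*} {r : V → V → Prop} {s : V}
    (h : ∀ v, Relation.ReflTransGen r s v) :
    ∃ d : V → ℕ, ∀ w, w ≠ s → ∃ v, r v w ∧ d v < d w := by
  classical
  let S : ℕ → V → Prop := fun n => Nat.rec (fun v => v = s) (fun _ S w => ∃ v, S v ∧ r v w) n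
  have hS : ∀ v, ∃ n, S n v := by
    intro v
    induction h v with
    | refl => exact ⟨0, rfl⟩
    | tail _ hbc ih =>
      obtain ⟨n, hn⟩ := ih
      exact ⟨n + 1, _, hn, hbc⟩
  have hS' : ∀ v, ∃ n, S n v ∧ ∀ m, S m v → n ≤ m := fun v => by
    obtain ⟨n, hn, hmin⟩ := wellFounded_lt.has_min {n | S n v} (hS v)
    -- The depth is the least length of a walk from `s`, so the last step of a shortest walk starts
    -- at smaller depth.
    exact ⟨n, hn, fun m hm => not_lt.1 (hmin m hm)⟩
  choose d hd using hS'
  refine ⟨d, fun w hw => ?_⟩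
  have h1 := (hd w).1
  rcases hn : d w with _ | n
  · rw [hn] at h1
    exact absurd h1 hw
  · rw [hn] at h1
    obtain ⟨v, hv, hr⟩ := h1
    exact ⟨v, hr, Nat.lt_succ_of_le ((hd v).2 n hv)⟩

/-- Finitely many lexicographically positive vectors are positive for a common weight. -/
theorem exists_weights_of_lex_pos {ι : Type*} [Finite ι] (n : ℕ) (θ : ι → ℕ → ℝ)
    (h : ∀ i, ∃ k < n, (∀ j < k, 0 ≤ θ i j) ∧ 0 < θ i k) :
    ∃ ω : ℕ → ℝ, (∀ j, 0 ≤ ω j) ∧ ∀ i, 0 < ∑ j ∈ Finset.range n, ω j * θ i j := by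
  induction n generalizing ι with
  | zero => exact ⟨0, fun _ => le_rfl, fun i => by obtain ⟨k, hk, -⟩ := h i; omega⟩
  | succ n ih =>
    obtain ⟨ω, hω, hpos⟩ := ih (ι := {i // θ i 0 ≤ 0}) (fun i j => θ i (j + 1)) (by
      rintro ⟨i, hi⟩
      obtain ⟨k, hk, hlt, hkp⟩ := h i
      rcases k with _ | k
      · exact absurd hkp (not_lt.2 hi)
      · exact ⟨k, by omega, fun j hj => hlt (j + 1) (by omega), hkp⟩)
    have h0 : ∀ i, θ i 0 ≤ 0 → θ i 0 = 0 := by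
      intro i hi
      obtain ⟨k, hk, hlt, hkp⟩ := h i
      rcases k with _ | k
      · exact absurd hkp (not_lt.2 hi)
      · exact le_antisymm hi (hlt 0 (by omega))
    -- The leading weight must outweigh the tail wherever the leading entry is positive; where it
    -- vanishes, the induction hypothesis already applies.
    obtain ⟨M, hM⟩ := (Set.finite_range fun i =>
      (-∑ j ∈ Finset.range n, ω j * θ i (j + 1)) / θ i 0).bddAbove
    refine ⟨fun j => Nat.casesOn j (max M 0 + 1) ω, fun j => ?_, fun i => ?_⟩
    · rcases j with _ | j
      · exact add_nonneg (le_max_right _ _) zero_le_one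
      · exact hω j
    · rw [Finset.sum_range_succ']
      change 0 < ∑ j ∈ Finset.range n, ω j * θ i (j + 1) + (max M 0 + 1) * θ i 0
      rcases le_or_gt (θ i 0) 0 with hi | hi
      · rw [h0 i hi, mul_zero, add_zero]
        exact hpos ⟨i, hi⟩
      · have h1 := hM ⟨i, rfl⟩
        rw [div_le_iff₀ hi] at h1
        have h2 : M * θ i 0 ≤ max M 0 * θ i 0 :=
          mul_le_mul_of_nonneg_right (le_max_left _ _) hi.le
        linarith

theorem exists_pos_mul_le {ι : Type*} [Finite ι] (f g : ι → ℝ)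
    (hf : ∀ i, 0 < f i) : ∃ c > 0, ∀ i, c * g i ≤ f i := by
  obtain ⟨M, hM⟩ := (Set.finite_range fun i => g i / f i).bddAbove
  refine ⟨(max M 0 + 1)⁻¹, by positivity, fun i => ?_⟩
  have h1 := hM ⟨i, rfl⟩
  rw [div_le_iff₀ (hf i)] at h1
  rw [inv_mul_le_iff₀ (by positivity)]
  have h2 : M * f i ≤ max M 0 * f i := mul_le_mul_of_nonneg_right (le_max_left _ _) (hf i).le
  linarith [hf i]

end Combinatorics

/-! ### The growth rate of the Lyapunov function -/

section Lyapunov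

variable {V E : Type*} [Fintype V] [Fintype E] (N : FlowNetwork V E)

open Classical in
/-- The rate of change of `∑ₑ αₑ min(qₑ, 0) - βₑ max(qₑ, 0)`, where `qₑ = l_w - l_v - τₑ`, in the
configuration `(A, R)` and in direction `mu`. -/
noncomputable def lyapunovRate (α β : E → ℝ) (A R : Set E) (mu : V → ℝ) : ℝ :=
  ∑ e, ((if e ∈ A then 0 else α e) - (if e ∈ R then β e else 0)) *
    (mu (N.tgt e) - mu (N.src e))

/-- `par` selects arcs of a spanning tree rooted at the source, whose arcs belong to `B`, and along
which `d` increases. -/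
structure IsSpanningTree (B : Set E) (d : V → ℕ) (par : V → E) : Prop where
  mem : ∀ w, w ≠ N.s → par w ∈ B
  tgt_par : ∀ w, w ≠ N.s → N.tgt (par w) = w
  lt : ∀ w, w ≠ N.s → d (N.src (par w)) < d w

open Classical in
/-- The contribution of the tree arcs at depth `j` outside of `A`. -/
noncomputable def layerRate (d : V → ℕ) (par : V → E) (A : Set E) (mu : V → ℝ) (j : ℕ) : ℝ :=
  ∑ e, if e ∉ A ∧ N.tgt e ≠ N.s ∧ par (N.tgt e) = e ∧ d (N.tgt e) = j then
    mu (N.tgt e) - mu (N.src e) else 0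

variable {N}

theorem Reachable.mono_arcs {B C : Set E} {v w : V} (h : N.Reachable B v w) (hBC : B ⊆ C) :
    N.Reachable C v w := by
  induction h with
  | refl => exact Relation.ReflTransGen.refl
  | tail _ hbc ih =>
    obtain ⟨e, he, h⟩ := hbc
    exact ih.tail ⟨e, hBC he, h⟩

theorem exists_isSpanningTree {B : Set E} [Nonempty E] (h : ∀ v, N.Reachable B N.s v) :
    ∃ d par, N.IsSpanningTree B d par := by
  obtain ⟨d, hd⟩ := exists_depth h
  have : ∀ w, ∃ e, w ≠ N.s → e ∈ B ∧ N.tgt e = w ∧ d (N.src e) < d w := by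
    intro w
    by_cases hw : w = N.s
    · exact ⟨Classical.arbitrary E, fun h => absurd hw h⟩
    · obtain ⟨v, ⟨e, he, rfl, h2⟩, h3⟩ := hd w hw
      exact ⟨e, fun _ => ⟨he, h2, h3⟩⟩
  choose par hpar using this
  exact ⟨d, par, fun w hw => (hpar w hw).1, fun w hw => (hpar w hw).2.1,
    fun w hw => (hpar w hw).2.2⟩

variable [DecidableEq V]

open Classical in
/-- The rate of the Lyapunov function is a sum of nonnegative terms. -/
theorem lyapunovRate_eq {P Q A R : Set E} {y x : E → ℝ} {lam mu : V → ℝ}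
    (hy : N.IsComplementary P Q y lam) (hlam : ∀ v, 0 < lam v)
    (hx : N.IsComplementary A R x mu) (hmu : ∀ v, 0 < mu v)
    (htight : ∀ e ∈ A, e ∉ R → mu (N.tgt e) = mu (N.src e)) (hRA : R ⊆ A) :
    N.lyapunovRate (fun e => y e / lam (N.tgt e)) (fun e => N.ν e - y e / lam (N.tgt e)) A R mu =
      ∑ e, (y e / lam (N.tgt e) - x e / mu (N.tgt e)) * mu (N.src e) *
        (lam (N.tgt e) / lam (N.src e) - 1) +
      ∑ e, x e * ((mu (N.src e) / lam (N.src e)) / (mu (N.tgt e) / lam (N.tgt e)) - 1 -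
        Real.log ((mu (N.src e) / lam (N.src e)) / (mu (N.tgt e) / lam (N.tgt e)))) +
      N.u₀ * (mu N.t / lam N.t - Real.log (mu N.t / lam N.t) - 1) := by
  have h1 := hx.flow.sum_mul_sub fun v => mu v / lam v
  have h2 := hy.flow.sum_mul_sub fun v => mu v / lam v
  have h3 := hx.flow.sum_mul_sub fun v => mu v / lam v - Real.log (mu v / lam v)
  simp only [hx.source, hy.source, div_one, Real.log_one, sub_zero] at h3
  -- Both flows have value `u₀`, so testing `x` and `y` with the ratio `mu / lam` gives equal values
  -- and the bracket added here is zero. It and the logarithmic potential are what makes the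
  -- identity hold arc by arc.
  have h4 : N.u₀ * (mu N.t / lam N.t - Real.log (mu N.t / lam N.t) - 1) =
      ∑ e, x e * (mu (N.tgt e) / lam (N.tgt e) - Real.log (mu (N.tgt e) / lam (N.tgt e)) -
        (mu (N.src e) / lam (N.src e) - Real.log (mu (N.src e) / lam (N.src e)))) +
      (∑ e, y e * (mu (N.tgt e) / lam (N.tgt e) - mu (N.src e) / lam (N.src e)) -
        ∑ e, x e * (mu (N.tgt e) / lam (N.tgt e) - mu (N.src e) / lam (N.src e))) := by
    rw [h1, h2, h3]
    ring
  rw [h4, ← Finset.sum_sub_distrib, ← Finset.sum_add_distrib, ← Finset.sum_add_distrib,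
    ← Finset.sum_add_distrib]
  refine Finset.sum_congr rfl fun e _ => ?_
  -- One formula covers all three cases: `x` vanishes off `A`, it is saturated on `R`, and on the
  -- remaining arcs `mu` does not change.
  have hcoef : ((if e ∈ A then 0 else y e / lam (N.tgt e)) -
      (if e ∈ R then N.ν e - y e / lam (N.tgt e) else 0)) * (mu (N.tgt e) - mu (N.src e)) =
      (y e / lam (N.tgt e) - x e / mu (N.tgt e)) * (mu (N.tgt e) - mu (N.src e)) := by
    by_cases hA : e ∈ A
    · by_cases hR : e ∈ R
      · rw [if_pos hA, if_pos hR, hx.reset e hR, mul_div_cancel_right₀ _ (hmu _).ne']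
        ring
      · simp [htight e hA hR]
    · rw [if_neg hA, if_neg fun h => hA (hRA h), hx.support e hA]
      ring
  rw [hcoef, Real.log_div (div_pos (hmu _) (hlam _)).ne' (div_pos (hmu _) (hlam _)).ne']
  have a1 := (hmu (N.tgt e)).ne'
  have a2 := (hmu (N.src e)).ne'
  have a3 := (hlam (N.tgt e)).ne'
  have a4 := (hlam (N.src e)).ne'
  field_simp
  ring

section

variable {P Q A R : Set E} {y x : E → ℝ} {lam mu : V → ℝ}

/-- Where `lam` increases, `y` is saturated and `x` cannot exceed saturation; where `lam` decreases,
`y` vanishes, except on `Q`, where both are saturated. So the two factors agree in sign. -/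
theorem slack_nonneg
    (hy : N.IsComplementary P Q y lam) (hlam : ∀ v, 0 < lam v)
    (hx : N.IsComplementary A R x mu) (hmu : ∀ v, 0 < mu v)
    (hQR : Q ⊆ R) (hAP : A ⊆ P) (e : E) :
    0 ≤ (y e / lam (N.tgt e) - x e / mu (N.tgt e)) * mu (N.src e) *
        (lam (N.tgt e) / lam (N.src e) - 1) := by
  rw [mul_right_comm]
  refine mul_nonneg ?_ (hmu _).le
  have hle : x e / mu (N.tgt e) ≤ N.ν e := by
    rw [div_le_iff₀ (hmu _)]
    exact hx.le e
  by_cases hP : e ∈ P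
  · rcases lt_trichotomy (lam (N.src e)) (lam (N.tgt e)) with hlt | heq | hlt
    · refine mul_nonneg ?_ ?_
      · rw [hy.up e hP hlt, mul_div_cancel_right₀ _ (hlam _).ne']
        exact sub_nonneg.2 hle
      · rw [sub_nonneg, one_le_div (hlam _)]
        exact hlt.le
    · rw [heq, div_self (hlam _).ne', sub_self, mul_zero]
    · by_cases hQ : e ∈ Q
      · rw [hy.reset e hQ, hx.reset e (hQR hQ), mul_div_cancel_right₀ _ (hlam _).ne',
          mul_div_cancel_right₀ _ (hmu _).ne', sub_self, zero_mul]
      · refine mul_nonneg_of_nonpos_of_nonpos ?_ ?_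
        · rw [hy.down e hQ hlt, zero_div, zero_sub, neg_nonpos]
          exact div_nonneg (hx.flow.1 e) (hmu _).le
        · rw [sub_nonpos, div_le_one (hlam _)]
          exact hlt.le
  · rw [hy.support e hP, hx.support e fun h => hP (hAP h)]
    simp

theorem sub_one_sub_log_nonneg {a : ℝ} (ha : 0 < a) : 0 ≤ a - 1 - Real.log a := by
  linarith [Real.log_le_sub_one_of_pos ha]

theorem lyapunovRate_nonneg
    (hy : N.IsComplementary P Q y lam) (hlam : ∀ v, 0 < lam v)
    (hx : N.IsComplementary A R x mu) (hmu : ∀ v, 0 < mu v)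
    (htight : ∀ e ∈ A, e ∉ R → mu (N.tgt e) = mu (N.src e)) (hRA : R ⊆ A)
    (hQR : Q ⊆ R) (hAP : A ⊆ P) :
    0 ≤ N.lyapunovRate (fun e => y e / lam (N.tgt e)) (fun e => N.ν e - y e / lam (N.tgt e))
      A R mu := by
  rw [lyapunovRate_eq hy hlam hx hmu htight hRA]
  refine add_nonneg (add_nonneg (Finset.sum_nonneg fun e _ => slack_nonneg hy hlam hx hmu hQR hAP e)
    (Finset.sum_nonneg fun e _ => mul_nonneg (hx.flow.1 e) (sub_one_sub_log_nonneg ?_)))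
    (mul_nonneg N.u₀_pos.le ?_)
  · exact div_pos (div_pos (hmu _) (hlam _)) (div_pos (hmu _) (hlam _))
  · linarith [sub_one_sub_log_nonneg (div_pos (hmu N.t) (hlam N.t))]

theorem eq_of_lyapunovRate_eq_zero
    (hy : N.IsComplementary P Q y lam) (hlam : ∀ v, 0 < lam v)
    (hx : N.IsComplementary A R x mu) (hmu : ∀ v, 0 < mu v)
    (htight : ∀ e ∈ A, e ∉ R → mu (N.tgt e) = mu (N.src e)) (hRA : R ⊆ A)
    (hQR : Q ⊆ R) (hAP : A ⊆ P)
    (h0 : N.lyapunovRate (fun e => y e / lam (N.tgt e)) (fun e => N.ν e - y e / lam (N.tgt e))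
      A R mu = 0) :
    (∀ e, (y e / lam (N.tgt e) - x e / mu (N.tgt e)) * mu (N.src e) *
        (lam (N.tgt e) / lam (N.src e) - 1) = 0) ∧
    ∀ e, 0 < x e → mu (N.src e) / lam (N.src e) = mu (N.tgt e) / lam (N.tgt e) := by
  have hr : ∀ v, 0 < mu v / lam v := fun v => div_pos (hmu v) (hlam v)
  rw [lyapunovRate_eq hy hlam hx hmu htight hRA] at h0
  have t1 : ∀ e ∈ Finset.univ, 0 ≤ (y e / lam (N.tgt e) - x e / mu (N.tgt e)) * mu (N.src e) *
      (lam (N.tgt e) / lam (N.src e) - 1) := fun e _ => slack_nonneg hy hlam hx hmu hQR hAP e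
  have t2 : ∀ e ∈ Finset.univ, 0 ≤
      x e * ((mu (N.src e) / lam (N.src e)) / (mu (N.tgt e) / lam (N.tgt e)) - 1 -
        Real.log ((mu (N.src e) / lam (N.src e)) / (mu (N.tgt e) / lam (N.tgt e)))) := fun e _ =>
    mul_nonneg (hx.flow.1 e) (sub_one_sub_log_nonneg (div_pos (hr _) (hr _)))
  have t3 : 0 ≤ N.u₀ * (mu N.t / lam N.t - Real.log (mu N.t / lam N.t) - 1) :=
    mul_nonneg N.u₀_pos.le (by linarith [sub_one_sub_log_nonneg (hr N.t)])
  have s1 := Finset.sum_nonneg t1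
  have s2 := Finset.sum_nonneg t2
  have e1 := (Finset.sum_eq_zero_iff_of_nonneg t1).1 (by linarith)
  have e2 := (Finset.sum_eq_zero_iff_of_nonneg t2).1 (by linarith)
  refine ⟨fun e => e1 e (Finset.mem_univ e), fun e hpos => ?_⟩
  have h2 := (mul_eq_zero.1 (e2 e (Finset.mem_univ e))).resolve_left hpos.ne'
  by_contra hne
  have hne' : (mu (N.src e) / lam (N.src e)) / (mu (N.tgt e) / lam (N.tgt e)) ≠ 1 := by
    rwa [Ne, div_eq_one_iff_eq (hr _).ne']
  have := Real.log_lt_sub_one_of_pos (div_pos (hr (N.src e)) (hr (N.tgt e))) hne'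
  linarith

/-- The ratio `mu / lam` is 1 at the source and does not drop along a supporting arc of `mu`. If the
arc carries `x`, equality in the logarithm inequality preserves the ratio; otherwise `mu` is
constant along it, and the vanishing slack term prevents `lam` from increasing. -/
theorem le_of_lyapunovRate_eq_zero
    (hy : N.IsComplementary P Q y lam) (hlam : ∀ v, 0 < lam v)
    (hx : N.IsComplementary A R x mu) (hmu : ∀ v, 0 < mu v)
    (htight : ∀ e ∈ A, e ∉ R → mu (N.tgt e) = mu (N.src e)) (hRA : R ⊆ A)
    (hQR : Q ⊆ R) (hAP : A ⊆ P) (hwf : WellFounded (N.Adj A))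
    (h0 : N.lyapunovRate (fun e => y e / lam (N.tgt e)) (fun e => N.ν e - y e / lam (N.tgt e))
      A R mu = 0) (v : V) : lam v ≤ mu v := by
  obtain ⟨hs, he⟩ := eq_of_lyapunovRate_eq_zero hy hlam hx hmu htight hRA hQR hAP h0
  rw [← one_le_div (hlam v)]
  induction v using hwf.induction with
  | _ w ih =>
    by_cases hw : w = N.s
    · rw [hw, hx.source, hy.source, div_one]
    · rcases Relation.ReflTransGen.cases_tail (hx.grounded w) with h1 | ⟨c, -, e, hmem, rfl, rfl⟩
      · exact absurd h1 hw
      · have hv := ih _ ⟨e, hmem.1, rfl, rfl⟩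
        rcases (hx.flow.1 e).eq_or_lt with hx0 | hpos
        · have heR : e ∉ R := by
            intro heR
            have := hx.reset e heR
            rw [← hx0] at this
            exact (mul_pos (N.ν_pos e) (hmu (N.tgt e))).ne this
          have hmueq := htight e hmem.1 heR
          have hs' := hs e
          rw [← hx0, zero_div, sub_zero] at hs'
          have hlamle : lam (N.tgt e) ≤ lam (N.src e) := by
            by_contra! hlt
            rw [hy.up e (hAP hmem.1) hlt, mul_div_cancel_right₀ _ (hlam _).ne'] at hs'
            have : 0 < lam (N.tgt e) / lam (N.src e) - 1 := by
              rw [sub_pos, one_lt_div (hlam _)]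
              exact hlt
            exact (mul_pos (mul_pos (N.ν_pos e) (hmu _)) this).ne' hs'
          rw [hmueq]
          exact hv.trans (div_le_div_of_nonneg_left (hmu _).le (hlam _) hlamle)
        · rw [← he e hpos]
          exact hv

theorem layerRate_nonneg {d : V → ℕ} {par : V → E}
    (htree : N.IsSpanningTree (N.supportArcs P Q lam) d par) (hRA : R ⊆ A) (hQR : Q ⊆ R)
    (hle : ∀ v, lam v ≤ mu v) {j : ℕ}
    (hj : ∀ w, d w < j → mu w = lam w) : 0 ≤ N.layerRate d par A mu j := by
  refine Finset.sum_nonneg fun e _ => ?_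
  split_ifs with h
  · obtain ⟨hA, hs, hpar, hd⟩ := h
    have h1 := htree.mem _ hs
    have h2 := htree.lt _ hs
    rw [hpar] at h1 h2
    have h3 := h1.2.resolve_left fun h => hA (hRA (hQR h))
    rw [hj _ (lt_of_lt_of_eq h2 hd)]
    linarith [hle (N.tgt e)]
  · exact le_rfl

/-- At the first depth where `mu` and `lam` differ, the tree arc into `w` must have left `A`. In `R`
it would carry `x`, forcing ratio 1 at `w`; in `A` outside `R` it would force `mu w ≤ lam w`. Having
left `A`, it contributes to the layer with a strict increase of `mu`. -/
theorem layerRate_pos {d : V → ℕ} {par : V → E}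
    (hy : N.IsComplementary P Q y lam) (hlam : ∀ v, 0 < lam v)
    (hx : N.IsComplementary A R x mu) (hmu : ∀ v, 0 < mu v)
    (htree : N.IsSpanningTree (N.supportArcs P Q lam) d par)
    (htight : ∀ e ∈ A, e ∉ R → mu (N.tgt e) = mu (N.src e)) (hRA : R ⊆ A) (hQR : Q ⊆ R)
    (hle : ∀ v, lam v ≤ mu v)
    (he : ∀ e, 0 < x e → mu (N.src e) / lam (N.src e) = mu (N.tgt e) / lam (N.tgt e))
    {w : V} (hj : ∀ w', d w' < d w → mu w' = lam w') (hw : mu w ≠ lam w) :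
    0 < N.layerRate d par A mu (d w) := by
  have hs : w ≠ N.s := by
    rintro rfl
    exact hw (by rw [hx.source, hy.source])
  have hmem := htree.mem w hs
  have htgt := htree.tgt_par w hs
  have hsrc := hj _ (htree.lt w hs)
  have hlt : lam w < mu w := lt_of_le_of_ne (hle w) hw.symm
  have hnA : par w ∉ A := by
    intro hA
    by_cases hR : par w ∈ R
    · have hpos : 0 < x (par w) := by
        rw [hx.reset _ hR]
        exact mul_pos (N.ν_pos _) (hmu _)
      have h1 := he _ hpos
      rw [hsrc, div_self (hlam _).ne', htgt, eq_comm, div_eq_one_iff_eq (hlam _).ne'] at h1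
      exact hw h1
    · have h1 := htight _ hA hR
      rw [hsrc, htgt] at h1
      have h2 := hmem.2.resolve_left fun h => hR (hQR h)
      rw [htgt] at h2
      linarith
  refine Finset.sum_pos' (fun e _ => ?_) ⟨par w, Finset.mem_univ _, ?_⟩
  · split_ifs with h
    · obtain ⟨hA, hs, hpar, hd⟩ := h
      have h1 := htree.mem _ hs
      have h2 := htree.lt _ hs
      rw [hpar] at h1 h2
      have h3 := h1.2.resolve_left fun h => hA (hRA (hQR h))
      rw [hj _ (lt_of_lt_of_eq h2 hd)]
      linarith [hle (N.tgt e)]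
    · exact le_rfl
  · rw [if_pos ⟨hnA, by rwa [htgt], by rw [htgt], by rw [htgt]⟩, htgt, hsrc]
    have h2 := hmem.2.resolve_left fun h => hnA (hRA (hQR h))
    rw [htgt] at h2
    linarith

/-- Either the label derivatives agree, or the Lyapunov rates are lexicographically positive. -/
theorem eq_or_lex_pos {d : V → ℕ} {par : V → E}
    (hy : N.IsComplementary P Q y lam) (hlam : ∀ v, 0 < lam v)
    (hx : N.IsComplementary A R x mu) (hmu : ∀ v, 0 < mu v)
    (htree : N.IsSpanningTree (N.supportArcs P Q lam) d par)
    (htight : ∀ e ∈ A, e ∉ R → mu (N.tgt e) = mu (N.src e)) (hRA : R ⊆ A) (hQR : Q ⊆ R)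
    (hAP : A ⊆ P) (hwf : WellFounded (N.Adj A)) (hne : mu ≠ lam) :
    0 < N.lyapunovRate (fun e => y e / lam (N.tgt e)) (fun e => N.ν e - y e / lam (N.tgt e))
      A R mu ∨
    ∃ w, (∀ j < d w, 0 ≤ N.layerRate d par A mu j) ∧ 0 < N.layerRate d par A mu (d w) := by
  rcases (lyapunovRate_nonneg hy hlam hx hmu htight hRA hQR hAP).lt_or_eq with h | h
  · exact Or.inl h
  · right
    have hle := le_of_lyapunovRate_eq_zero hy hlam hx hmu htight hRA hQR hAP hwf h.symm
    obtain ⟨-, he⟩ := eq_of_lyapunovRate_eq_zero hy hlam hx hmu htight hRA hQR hAP h.symm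
    have hex : ∃ k, ∃ w, d w = k ∧ mu w ≠ lam w := by
      obtain ⟨w, hw⟩ := Function.ne_iff.1 hne
      exact ⟨_, w, rfl, hw⟩
    classical
    obtain ⟨w, hd, hw⟩ := Nat.find_spec hex
    have hmin : ∀ w', d w' < d w → mu w' = lam w' := by
      intro w' hw'
      by_contra hcon
      exact Nat.find_min hex (hd ▸ hw') ⟨w', rfl, hcon⟩
    exact ⟨w, fun j hj => layerRate_nonneg htree hRA hQR hle
      fun w' hw' => hmin w' (hw'.trans hj),
      layerRate_pos hy hlam hx hmu htree htight hRA hQR hle he hmin hw⟩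

end

variable (N) in
/-- The arcs that have a queue immediately after leaving the configuration `(A, R)` in direction
`lam`. -/
def queueingArcs (A R : Set E) (lam : V → ℝ) : Set E :=
  {e | e ∈ A ∧ (e ∈ R ∨ lam (N.src e) < lam (N.tgt e))}

/-- The pair still solves the system in the configuration just after departure. There, arcs that are
active but not resetting are tight for `lam`, which is what the rate formula needs, and the
direction can be followed for some time. -/
theorem IsComplementary.refine {A R : Set E} {x : E → ℝ} {lam : V → ℝ}
    (h : N.IsComplementary A R x lam) :
    N.IsComplementary (N.supportArcs A R lam) (N.queueingArcs A R lam) x lam := by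
  refine ⟨h.flow, ?_, h.source, h.nonneg, ?_, h.le, fun e he => h.up e he.1, ?_, ?_⟩
  · intro e he
    by_cases heA : e ∈ A
    · have h1 : ¬ (e ∈ R ∨ lam (N.src e) ≤ lam (N.tgt e)) := fun h => he ⟨heA, h⟩
      push Not at h1
      exact h.down e h1.1 h1.2
    · exact h.support e heA
  · rintro e ⟨heA, he | he⟩
    · exact h.reset e he
    · exact h.up e heA he
  · intro e he hlt
    by_cases heA : e ∈ A
    · exact h.down e (fun h => he ⟨heA, Or.inl h⟩) hlt
    · exact h.support e heA
  · exact fun v => (h.grounded v).mono_arcs fun e he =>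
      ⟨he, he.2.imp_left fun h => ⟨he.1, Or.inl h⟩⟩

/-- The label derivatives of a thin flow are determined by the configuration. -/
theorem IsThinFlow.unique {A R : Set E} (hA : N.IsFeasibleConfig A R) {x y : E → ℝ}
    {lam mu : V → ℝ} (hy : N.IsThinFlow A R y lam) (hx : N.IsThinFlow A R x mu) : mu = lam := by
  have hyc := hy.isComplementary hA
  have hxc := hx.isComplementary hA
  have hlam := hy.pos hA
  have hmu := hx.pos hA
  let R' : Set E := N.queueingArcs A R mu
  let A' : Set E := N.supportArcs A R mu
  have hRA : R' ⊆ A' := fun e he => ⟨he.1, he.2.imp_right le_of_lt⟩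
  have htight : ∀ e ∈ A', e ∉ R' → mu (N.tgt e) = mu (N.src e) := by
    intro e he hR
    have h1 : ¬ (e ∈ R ∨ mu (N.src e) < mu (N.tgt e)) := fun h => hR ⟨he.1, h⟩
    push Not at h1
    exact le_antisymm h1.2 (he.2.resolve_left h1.1)
  have hxc' : N.IsComplementary A' R' x mu := hxc.refine
  have : Nonempty E := (hxc.flow.exists_pos_sink).nonempty
  obtain ⟨d, par, htree⟩ := exists_isSpanningTree hyc.grounded
  have hAP : A' ⊆ A := fun e he => he.1
  have hQR : R ⊆ R' := fun e he => ⟨hA.subset he, Or.inl he⟩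
  have hwf : WellFounded (N.Adj A') :=
    Subrelation.wf (fun ⟨e, he, h⟩ => ⟨e, hAP he, h⟩) hA.wf
  by_contra hne
  -- The Lyapunov terms are maximal for the configuration `(A, R)`, so departing from it in
  -- direction `mu` cannot increase any of them. Term by term this contradicts both alternatives.
  rcases eq_or_lex_pos hyc hlam hxc' hmu htree htight hRA hQR hAP hwf hne with h | ⟨w, -, h⟩
  · refine h.not_ge (Finset.sum_nonpos fun e _ => ?_)
    beta_reduce
    have hα : 0 ≤ y e / lam (N.tgt e) := div_nonneg (hyc.flow.1 e) (hlam _).le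
    have hβ : y e / lam (N.tgt e) ≤ N.ν e := by
      rw [div_le_iff₀ (hlam _)]
      exact hyc.le e
    by_cases heR : e ∈ R'
    · rw [if_pos heR, if_pos (hRA heR), zero_sub]
      rcases heR with ⟨heA, he | he⟩
      · rw [hyc.reset e he, mul_div_cancel_right₀ _ (hlam _).ne']
        simp
      · exact mul_nonpos_of_nonpos_of_nonneg (by linarith) (by linarith)
    · rw [if_neg heR, sub_zero]
      split_ifs with heA'
      · rw [zero_mul]
      · by_cases heA : e ∈ A
        · have h1 : ¬ (e ∈ R ∨ mu (N.src e) ≤ mu (N.tgt e)) := fun h => heA' ⟨heA, h⟩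
          push Not at h1
          exact mul_nonpos_of_nonneg_of_nonpos hα (by linarith)
        · rw [hyc.support e heA]
          simp
  · refine h.not_ge (Finset.sum_nonpos fun e _ => ?_)
    split_ifs with h
    · obtain ⟨hA', hs, hpar, -⟩ := h
      have h1 := htree.mem _ hs
      rw [hpar] at h1
      have h2 : ¬ (e ∈ R ∨ mu (N.src e) ≤ mu (N.tgt e)) := fun h => hA' ⟨h1.1, h⟩
      push Not at h2
      linarith
    · exact le_rfl

/-- There are finitely many configurations, and each determines its label derivatives. This
finiteness yields the speed bound and every uniform gap used later. -/
theorem finite_thinFlows : {c : (Set E × Set E) × (V → ℝ) | N.IsFeasibleConfig c.1.1 c.1.2 ∧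
    ∃ x, N.IsThinFlow c.1.1 c.1.2 x c.2}.Finite := by
  refine Set.Finite.of_finite_image (f := Prod.fst) (Set.toFinite _) ?_
  rintro ⟨c, mu⟩ ⟨hc, x, hx⟩ ⟨c', mu'⟩ ⟨hc', x', hx'⟩ h
  obtain rfl : c = c' := h
  exact congrArg (Prod.mk c) (IsThinFlow.unique hc hx' hx)

theorem exists_norm_le_of_isThinFlow (N : FlowNetwork V E) :
    ∃ K : ℝ≥0, ∀ A R x mu, N.IsFeasibleConfig A R → N.IsThinFlow A R x mu → ‖mu‖ ≤ K := by
  obtain ⟨K, hK⟩ := (N.finite_thinFlows.image fun c => ‖c.2‖).bddAbove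
  refine ⟨K.toNNReal, fun A R x mu h1 h2 => ?_⟩
  exact (hK ⟨((A, R), mu), ⟨h1, x, h2⟩, rfl⟩).trans (Real.le_coe_toNNReal K)

-- The layer rates count exactly the tree arcs outside `A`, as the coefficients `α` do, so the
-- layers can be absorbed into `α`. Weights making all lexicographically positive rates positive
-- then exist, and finiteness turns positivity into a bound linear in `‖mu - lam‖`.
open Classical in
theorem exists_lyapunov {P Q : Set E} {y : E → ℝ} {lam : V → ℝ}
    (hy : N.IsComplementary P Q y lam) (hlam : ∀ v, 0 < lam v) :
    ∃ (α β : E → ℝ) (c : ℝ), (∀ e, 0 ≤ α e) ∧ (∀ e, 0 ≤ β e) ∧ (∀ e, e ∉ P → α e = 0) ∧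
      (∀ e ∈ Q, β e = 0) ∧ 0 < c ∧
      ∀ A R x mu, N.IsFeasibleConfig A R → N.IsThinFlow A R x mu → Q ⊆ R → A ⊆ P →
        (∀ e ∈ A, e ∉ R → mu (N.tgt e) = mu (N.src e)) →
        c * ‖mu - lam‖ ≤ N.lyapunovRate α β A R mu := by
  have : Nonempty E := (hy.flow.exists_pos_sink).nonempty
  obtain ⟨d, par, htree⟩ := exists_isSpanningTree hy.grounded
  obtain ⟨D, hD⟩ := (Set.finite_range d).bddAbove
  let S : Set ((Set E × Set E) × (V → ℝ)) := {c | (N.IsFeasibleConfig c.1.1 c.1.2 ∧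
    ∃ x, N.IsThinFlow c.1.1 c.1.2 x c.2) ∧ Q ⊆ c.1.2 ∧ c.1.1 ⊆ P ∧
    (∀ e ∈ c.1.1, e ∉ c.1.2 → c.2 (N.tgt e) = c.2 (N.src e)) ∧ c.2 ≠ lam}
  have : Finite S := (N.finite_thinFlows.subset fun c hc => hc.1).to_subtype
  let α₀ : E → ℝ := fun e => y e / lam (N.tgt e)
  let β₀ : E → ℝ := fun e => N.ν e - y e / lam (N.tgt e)
  -- Entry 0 is the basic rate and entry `j + 1` is layer `j`; depths up to `D` thus need `D + 2`
  -- entries.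
  let θ : S → ℕ → ℝ := fun c j => Nat.casesOn j (N.lyapunovRate α₀ β₀ c.1.1.1 c.1.1.2 c.1.2)
    fun j => N.layerRate d par c.1.1.1 c.1.2 j
  obtain ⟨ω, hω, hpos⟩ := exists_weights_of_lex_pos (D + 2) θ (by
    rintro ⟨⟨⟨A, R⟩, mu⟩, ⟨hA, x, hx⟩, hQR, hAP, htight, hne⟩
    have hxc := hx.isComplementary hA
    rcases eq_or_lex_pos hy hlam hxc (hx.pos hA) htree htight hA.subset hQR hAP hA.wf hne with
      h | ⟨w, h1, h2⟩
    · exact ⟨0, by omega, fun j hj => by omega, h⟩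
    · refine ⟨d w + 1, by have := hD ⟨w, rfl⟩; omega, fun j hj => ?_, h2⟩
      rcases j with _ | j
      · exact lyapunovRate_nonneg hy hlam hxc (hx.pos hA) htight hA.subset hQR hAP
      · exact h1 j (by omega))
  let α : E → ℝ := fun e => ω 0 * α₀ e +
    if N.tgt e ≠ N.s ∧ par (N.tgt e) = e then ω (d (N.tgt e) + 1) else 0
  let β : E → ℝ := fun e => ω 0 * β₀ e
  have hrate : ∀ A R mu, N.lyapunovRate α β A R mu = ω 0 * N.lyapunovRate α₀ β₀ A R mu +
      ∑ e, if e ∉ A ∧ N.tgt e ≠ N.s ∧ par (N.tgt e) = e then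
        ω (d (N.tgt e) + 1) * (mu (N.tgt e) - mu (N.src e)) else 0 := by
    intro A R mu
    simp only [lyapunovRate, Finset.mul_sum]
    rw [← Finset.sum_add_distrib]
    refine Finset.sum_congr rfl fun e _ => ?_
    simp only [α, β]
    by_cases h3 : N.tgt e ≠ N.s ∧ par (N.tgt e) = e
    · rw [if_pos h3]
      by_cases h1 : e ∈ A
      · have h2 : ¬ (e ∉ A ∧ N.tgt e ≠ N.s ∧ par (N.tgt e) = e) := fun h => h.1 h1
        rw [if_pos h1, if_neg h2]
        split_ifs <;> ring
      · have h2 : e ∉ A ∧ N.tgt e ≠ N.s ∧ par (N.tgt e) = e := ⟨h1, h3⟩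
        rw [if_neg h1, if_pos h2]
        split_ifs <;> ring
    · rw [if_neg h3, if_neg fun h : e ∉ A ∧ _ => h3 h.2]
      split_ifs <;> ring
  have hsum : ∀ c : S, ∑ j ∈ Finset.range (D + 2), ω j * θ c j =
      N.lyapunovRate α β c.1.1.1 c.1.1.2 c.1.2 := by
    intro c
    rw [Finset.sum_range_succ', hrate, add_comm]
    congr 1
    change ∑ j ∈ Finset.range (D + 1), ω (j + 1) * N.layerRate d par c.1.1.1 c.1.2 j = _
    simp only [layerRate, Finset.mul_sum]
    rw [Finset.sum_comm]
    refine Finset.sum_congr rfl fun e _ => ?_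
    rw [Finset.sum_eq_single (d (N.tgt e))]
    · by_cases h : e ∉ c.1.1.1 ∧ N.tgt e ≠ N.s ∧ par (N.tgt e) = e
      · rw [if_pos h, if_pos ⟨h.1, h.2.1, h.2.2, rfl⟩]
      · rw [if_neg h, if_neg fun h' => h ⟨h'.1, h'.2.1, h'.2.2.1⟩, mul_zero]
    · intro j _ hj
      rw [if_neg fun h' => hj h'.2.2.2.symm, mul_zero]
    · intro h
      have := hD ⟨N.tgt e, rfl⟩
      exact absurd (Finset.mem_range.2 (by omega)) h
  obtain ⟨c, hc, hcle⟩ := exists_pos_mul_le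
    (fun i : S => N.lyapunovRate α β i.1.1.1 i.1.1.2 i.1.2) (fun i : S => ‖i.1.2 - lam‖)
    (fun i => hsum i ▸ hpos i)
  have hα₀ : ∀ e, 0 ≤ α₀ e := fun e => div_nonneg (hy.flow.1 e) (hlam _).le
  refine ⟨α, β, c, ?_, ?_, ?_, ?_, hc, ?_⟩
  · intro e
    refine add_nonneg (mul_nonneg (hω 0) (hα₀ e)) ?_
    split_ifs
    · exact hω _
    · exact le_rfl
  · intro e
    refine mul_nonneg (hω 0) (sub_nonneg.2 ?_)
    rw [div_le_iff₀ (hlam _)]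
    exact hy.le e
  · intro e he
    have h1 : ¬ (N.tgt e ≠ N.s ∧ par (N.tgt e) = e) := by
      rintro ⟨h1, h2⟩
      have := (htree.mem _ h1).1
      rw [h2] at this
      exact he this
    simp only [α, α₀, if_neg h1, hy.support e he, zero_div, mul_zero, add_zero]
  · intro e he
    simp only [β, β₀, hy.reset e he, mul_div_cancel_right₀ _ (hlam (N.tgt e)).ne', sub_self,
      mul_zero]
  · intro A R x mu hA hx hQR hAP htight
    by_cases hne : mu = lam
    · rw [hne, sub_self, norm_zero, mul_zero, hrate]
      refine add_nonneg (mul_nonneg (hω 0) ?_) (Finset.sum_nonneg fun e _ => ?_)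
      · rw [← hne]
        exact lyapunovRate_nonneg hy hlam (hx.isComplementary hA) (hx.pos hA) htight hA.subset
          hQR hAP
      · split_ifs with h
        · have h1 := htree.mem _ h.2.1
          rw [h.2.2] at h1
          have h2 := h1.2.resolve_left fun h' => h.1 (hA.subset (hQR h'))
          exact mul_nonneg (hω _) (sub_nonneg.2 h2)
        · exact le_rfl
    · exact hcle ⟨((A, R), mu), ⟨hA, x, hx⟩, hQR, hAP, htight, hne⟩

end Lyapunov

end FlowNetwork

namespace FlowNetwork

/-! ### Maximal subsolutions of the regularized system -/

section Regularization

/-- The piecewise linear approximation of the Heaviside function. -/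
noncomputable def ramp (δ s : ℝ) : ℝ := max 0 (min 1 (s / δ))

theorem ramp_nonneg (δ s : ℝ) : 0 ≤ ramp δ s := le_max_left _ _

theorem ramp_le_one (δ s : ℝ) : ramp δ s ≤ 1 := max_le zero_le_one (min_le_left _ _)

theorem ramp_mono {δ : ℝ} (hδ : 0 < δ) : Monotone (ramp δ) := fun _ _ h =>
  max_le_max le_rfl (min_le_min le_rfl (div_le_div_of_nonneg_right h hδ.le))

theorem ramp_eq_one {δ s : ℝ} (hδ : 0 < δ) (h : δ ≤ s) : ramp δ s = 1 := by
  rw [ramp, min_eq_left ((one_le_div hδ).2 h), max_eq_right zero_le_one]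

theorem ramp_eq_zero {δ s : ℝ} (hδ : 0 < δ) (h : s ≤ 0) : ramp δ s = 0 := by
  rw [ramp, max_eq_left]
  exact (min_le_right _ _).trans (div_nonpos_of_nonpos_of_nonneg h hδ.le)

theorem ramp_pos {δ s : ℝ} (hδ : 0 < δ) (h : 0 < s) : 0 < ramp δ s :=
  lt_max_of_lt_right (lt_min one_pos (div_pos h hδ))

theorem continuous_ramp (δ : ℝ) : Continuous (ramp δ) := by
  unfold ramp
  fun_prop

variable {V E : Type*} [Fintype V] [Fintype E] (N : FlowNetwork V E)

open Classical in
/-- The flow that an arc carries in the regularized system when its tail has label `a` and its head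
has label `c`. -/
noncomputable def arcFlow (P Q : Set E) (δ : ℝ) (e : E) (a c : ℝ) : ℝ :=
  if e ∈ P then N.ν e * c * (if e ∈ Q then 1 else ramp δ (c - a)) else 0

/-- The flow of the regularized system. -/
noncomputable def regFlow (P Q : Set E) (δ : ℝ) (lam : V → ℝ) (e : E) : ℝ :=
  N.arcFlow P Q δ e (lam (N.src e)) (lam (N.tgt e))

variable {N} {P Q : Set E} {δ : ℝ}

theorem arcFlow_nonneg {e : E} {a c : ℝ} (hc : 0 ≤ c) : 0 ≤ N.arcFlow P Q δ e a c := by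
  unfold arcFlow
  split_ifs
  · exact mul_nonneg (mul_nonneg (N.ν_pos e).le hc) zero_le_one
  · exact mul_nonneg (mul_nonneg (N.ν_pos e).le hc) (ramp_nonneg _ _)
  · exact le_rfl

theorem arcFlow_le {e : E} {a c : ℝ} (hc : 0 ≤ c) : N.arcFlow P Q δ e a c ≤ N.ν e * c := by
  have h := mul_nonneg (N.ν_pos e).le hc
  unfold arcFlow
  split_ifs
  · rw [mul_one]
  · exact mul_le_of_le_one_right h (ramp_le_one _ _)
  · exact h

theorem arcFlow_anti_tail (hδ : 0 < δ) {e : E} {a a' c : ℝ} (hc : 0 ≤ c) (h : a ≤ a') :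
    N.arcFlow P Q δ e a' c ≤ N.arcFlow P Q δ e a c := by
  have h0 := mul_nonneg (N.ν_pos e).le hc
  unfold arcFlow
  split_ifs
  · exact le_rfl
  · exact mul_le_mul_of_nonneg_left (ramp_mono hδ (by linarith)) h0
  · exact le_rfl

theorem arcFlow_mono_head (hδ : 0 < δ) {e : E} {a c c' : ℝ} (hc : 0 ≤ c) (h : c ≤ c') :
    N.arcFlow P Q δ e a c ≤ N.arcFlow P Q δ e a c' := by
  have h0 := mul_le_mul_of_nonneg_left h (N.ν_pos e).le
  have h1 := mul_nonneg (N.ν_pos e).le (hc.trans h)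
  unfold arcFlow
  split_ifs
  · exact mul_le_mul_of_nonneg_right h0 zero_le_one
  · exact mul_le_mul h0 (ramp_mono hδ (by linarith)) (ramp_nonneg _ _) h1
  · exact le_rfl

theorem continuous_regFlow (P Q : Set E) (δ : ℝ) (e : E) :
    Continuous fun lam : V → ℝ => N.regFlow P Q δ lam e := by
  have := continuous_ramp δ
  unfold regFlow arcFlow
  split_ifs <;> fun_prop

theorem exists_arc_of_reachable {A : Set E} {v w : V} (h : N.Reachable A v w) {T : Set V}
    (hv : v ∉ T) (hw : w ∈ T) : ∃ e ∈ A, N.src e ∉ T ∧ N.tgt e ∈ T := by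
  induction h with
  | refl => exact absurd hw hv
  | @tail b c _ hbc ih =>
    obtain ⟨e, he, rfl, rfl⟩ := hbc
    by_cases hb : N.src e ∈ T
    · exact ih hb
    · exact ⟨e, he, hb, hw⟩

variable [DecidableEq V]

variable (N) in
/-- The amount by which the inflow into a vertex exceeds the outflow. -/
def excess (x : E → ℝ) (w : V) : ℝ := (∑ e with N.tgt e = w, x e) - ∑ e with N.src e = w, x e

theorem sum_mul_excess (x : E → ℝ) (f : V → ℝ) :
    ∑ v, f v * N.excess x v = ∑ e, x e * (f (N.tgt e) - f (N.src e)) := by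
  have h := N.sum_mul_outflow_sub_inflow x f
  have h1 : ∑ v, f v * N.excess x v =
      -∑ v, f v * ((∑ e with N.src e = v, x e) - (∑ e with N.tgt e = v, x e)) := by
    rw [← Finset.sum_neg_distrib]
    exact Finset.sum_congr rfl fun v _ => by rw [excess]; ring
  rw [h1, h, ← Finset.sum_neg_distrib]
  exact Finset.sum_congr rfl fun e _ => by ring

theorem continuous_excess_regFlow (P Q : Set E) (δ : ℝ) (w : V) :
    Continuous fun lam : V → ℝ => N.excess (N.regFlow P Q δ lam) w := by
  unfold excess
  exact (continuous_finsetSum _ fun e _ => continuous_regFlow P Q δ e).sub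
    (continuous_finsetSum _ fun e _ => continuous_regFlow P Q δ e)

variable (N) in
/-- Subsolutions of the regularized system. -/
def subsolutions (P Q : Set E) (δ : ℝ) : Set (V → ℝ) :=
  {lam | (∀ v, 0 ≤ lam v) ∧ lam N.s = 1 ∧
    ∀ w, w ≠ N.s → N.excess (N.regFlow P Q δ lam) w ≤ if w = N.t then N.u₀ else 0}

theorem isClosed_subsolutions : IsClosed (N.subsolutions P Q δ) := by
  have h : N.subsolutions P Q δ = (⋂ v, {lam | 0 ≤ lam v}) ∩ ({lam | lam N.s = 1} ∩
      ⋂ w, ⋂ (_ : w ≠ N.s), {lam | N.excess (N.regFlow P Q δ lam) w ≤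
        if w = N.t then N.u₀ else 0}) := by
    ext lam
    simp [subsolutions]
  rw [h]
  refine (isClosed_iInter fun v => isClosed_le continuous_const (continuous_apply v)).inter
    ((isClosed_eq (continuous_apply _) continuous_const).inter
      (isClosed_iInter fun w => isClosed_iInter fun _ =>
        isClosed_le (continuous_excess_regFlow P Q δ w) continuous_const))

theorem subsolutions_nonempty : (N.subsolutions P Q δ).Nonempty := by
  refine ⟨fun v => if v = N.s then 1 else 0, fun v => ?_, if_pos rfl, fun w hw => ?_⟩
  · dsimp only
    split_ifs <;> norm_num
  · have h1 : ∑ e with N.tgt e = w, N.regFlow P Q δ (fun v => if v = N.s then 1 else 0) e = 0 := by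
      refine Finset.sum_eq_zero fun e he => ?_
      rw [Finset.mem_filter] at he
      simp [regFlow, arcFlow, he.2, hw]
    have h2 : 0 ≤ ∑ e with N.src e = w, N.regFlow P Q δ (fun v => if v = N.s then 1 else 0) e := by
      refine Finset.sum_nonneg fun e _ => arcFlow_nonneg ?_
      dsimp only
      split_ifs <;> norm_num
    have h3 : (0 : ℝ) ≤ if w = N.t then N.u₀ else 0 := by
      split_ifs
      · exact N.u₀_pos.le
      · exact le_rfl
    rw [excess, h1]
    linarith

/-- The labels of a subsolution leave no large gaps. -/
theorem exists_mem_gap (hreach : ∀ v, N.Reachable P N.s v) (hδ : 0 < δ) (hδ1 : δ ≤ 1)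
    {lam : V → ℝ} (hlam : lam ∈ N.subsolutions P Q δ) {K M : ℝ} (hM : 1 ≤ M) (hK : 2 ≤ K)
    (hKν : ∀ e, N.u₀ + ∑ e', N.ν e' ≤ K * N.ν e) {v : V} (hv : K * M < lam v) :
    ∃ w, M < lam w ∧ lam w ≤ K * M := by
  classical
  by_contra! hgap
  obtain ⟨h0, hs, hex⟩ := hlam
  -- Across a gap, some arc into `T` is saturated and brings in more than `ν K M`, while every arc
  -- leaving `T` takes out at most `ν M`. The net inflow would exceed `u₀` by the choice of `K`.
  let T : Set V := {w | K * M < lam w}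
  have hKM : M ≤ K * M := le_mul_of_one_le_left (by linarith) (by linarith)
  have hsT : N.s ∉ T := by
    change ¬ (K * M < lam N.s)
    rw [hs]
    linarith
  have hT : ∀ w, w ∉ T → lam w ≤ M := by
    intro w hw
    by_contra! hcon
    exact hw (hgap w hcon)
  obtain ⟨e₀, he₀, hsrc, htgt⟩ := exists_arc_of_reachable (hreach v) hsT hv
  have h1 := sum_mul_excess (N := N) (N.regFlow P Q δ lam) (T.indicator 1)
  have h2 : ∑ w, T.indicator (1 : V → ℝ) w * N.excess (N.regFlow P Q δ lam) w ≤ N.u₀ := by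
    calc _ ≤ ∑ w, if w = N.t then N.u₀ else 0 := by
          refine Finset.sum_le_sum fun w _ => ?_
          by_cases hw : w ∈ T
          · rw [Set.indicator_of_mem hw, Pi.one_apply, one_mul]
            exact hex w fun h => hsT (h ▸ hw)
          · rw [Set.indicator_of_notMem hw, zero_mul]
            split_ifs
            · exact N.u₀_pos.le
            · exact le_rfl
      _ = N.u₀ := by simp
  have hX : ∀ e, 0 ≤ N.regFlow P Q δ lam e := fun e => arcFlow_nonneg (h0 _)
  have hterm : ∀ e, -(N.ν e * M) ≤ N.regFlow P Q δ lam e *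
      (T.indicator (1 : V → ℝ) (N.tgt e) - T.indicator (1 : V → ℝ) (N.src e)) := by
    intro e
    have hνM : 0 ≤ N.ν e * M := mul_nonneg (N.ν_pos e).le (by linarith)
    by_cases ht : N.tgt e ∈ T
    · rw [Set.indicator_of_mem ht]
      have : T.indicator (1 : V → ℝ) (N.src e) ≤ 1 := Set.indicator_le_self' (by simp) _
      have := mul_nonneg (hX e) (sub_nonneg.2 this)
      simp only [Pi.one_apply]
      linarith
    · rw [Set.indicator_of_notMem ht]
      have h3 : N.regFlow P Q δ lam e ≤ N.ν e * M := (arcFlow_le (h0 _)).trans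
        (mul_le_mul_of_nonneg_left (hT _ ht) (N.ν_pos e).le)
      by_cases hs' : N.src e ∈ T
      · rw [Set.indicator_of_mem hs', Pi.one_apply]
        linarith
      · rw [Set.indicator_of_notMem hs']
        linarith
  have hbig : N.ν e₀ * (K * M) < N.regFlow P Q δ lam e₀ *
      (T.indicator (1 : V → ℝ) (N.tgt e₀) - T.indicator (1 : V → ℝ) (N.src e₀)) := by
    rw [Set.indicator_of_mem htgt, Set.indicator_of_notMem hsrc, Pi.one_apply, sub_zero, mul_one]
    have h3 : K * M < lam (N.tgt e₀) := htgt
    have h4 := hT _ hsrc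
    have h5 : M + M ≤ K * M := by nlinarith
    have h6 : ramp δ (lam (N.tgt e₀) - lam (N.src e₀)) = 1 := ramp_eq_one hδ (by linarith)
    rw [regFlow, arcFlow, if_pos he₀, h6, ite_self, mul_one]
    exact mul_lt_mul_of_pos_left h3 (N.ν_pos e₀)
  have h7 : N.ν e₀ * (K * M) + ∑ e ∈ Finset.univ.erase e₀, -(N.ν e * M) <
      ∑ e, N.regFlow P Q δ lam e *
        (T.indicator (1 : V → ℝ) (N.tgt e) - T.indicator (1 : V → ℝ) (N.src e)) := by
    rw [← Finset.add_sum_erase _ _ (Finset.mem_univ e₀)]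
    exact add_lt_add_of_lt_of_le hbig (Finset.sum_le_sum fun e _ => hterm e)
  have h8 : -((∑ e, N.ν e) * M) ≤ ∑ e ∈ Finset.univ.erase e₀, -(N.ν e * M) := by
    rw [Finset.sum_neg_distrib, ← Finset.sum_mul, neg_le_neg_iff]
    refine mul_le_mul_of_nonneg_right ?_ (by linarith)
    exact Finset.sum_le_sum_of_subset_of_nonneg (Finset.erase_subset _ _)
      fun e _ _ => (N.ν_pos e).le
  have h9 := mul_le_mul_of_nonneg_right (hKν e₀) (by linarith : 0 ≤ M)
  have h10 : N.u₀ ≤ N.u₀ * M := le_mul_of_one_le_right N.u₀_pos.le hM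
  linarith

theorem exists_bound_subsolutions (hreach : ∀ v, N.Reachable P N.s v) :
    ∃ B : ℝ, ∀ (Q : Set E) (δ : ℝ), 0 < δ → δ ≤ 1 → ∀ lam ∈ N.subsolutions P Q δ,
      ∀ v, lam v ≤ B := by
  classical
  let S : ℝ := ∑ e, N.ν e
  have hS : 0 ≤ S := Finset.sum_nonneg fun e _ => (N.ν_pos e).le
  have hu := N.u₀_pos
  let K : ℝ := 2 + ∑ e, (N.u₀ + S) / N.ν e
  have hterm : ∀ e, 0 ≤ (N.u₀ + S) / N.ν e := fun e =>
    div_nonneg (by linarith) (N.ν_pos e).le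
  have hK : 2 ≤ K := le_add_of_nonneg_right (Finset.sum_nonneg fun e _ => hterm e)
  have hKν : ∀ e, N.u₀ + S ≤ K * N.ν e := by
    intro e
    rw [← div_le_iff₀ (N.ν_pos e)]
    have := Finset.single_le_sum (fun e _ => hterm e) (Finset.mem_univ e)
    simp only [K]
    linarith
  refine ⟨K ^ Fintype.card V, fun Q δ hδ hδ1 lam hlam v => ?_⟩
  -- As long as some label exceeds `K ^ (k + 1)`, the gap lemma puts a label between consecutive
  -- powers, so each power loses a vertex.
  have key : ∀ k : ℕ, (Finset.univ.filter fun v => K ^ k < lam v).card ≤ Fintype.card V - k := by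
    intro k
    induction k with
    | zero => exact (Finset.card_le_univ _).trans (by simp)
    | succ k ih =>
      rcases Finset.eq_empty_or_nonempty (Finset.univ.filter fun v => K ^ (k + 1) < lam v) with
        h | ⟨v, hv⟩
      · rw [h]
        simp
      · have hv' := (Finset.mem_filter.1 hv).2
        rw [pow_succ'] at hv'
        obtain ⟨w, hw1, hw2⟩ := exists_mem_gap hreach hδ hδ1 hlam
          (one_le_pow₀ (by linarith : 1 ≤ K)) hK hKν hv'
        have hlt : (Finset.univ.filter fun v => K ^ (k + 1) < lam v).card <
            (Finset.univ.filter fun v => K ^ k < lam v).card := by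
          refine Finset.card_lt_card ⟨fun v hv => ?_, fun h => ?_⟩
          · rw [Finset.mem_filter] at hv ⊢
            exact ⟨hv.1, (pow_le_pow_right₀ (by linarith) (Nat.le_succ k)).trans_lt hv.2⟩
          · have := (Finset.mem_filter.1 (h (Finset.mem_filter.2 ⟨Finset.mem_univ w, hw1⟩))).2
            rw [pow_succ'] at this
            exact absurd this (not_lt.2 hw2)
        omega
  have h1 := key (Fintype.card V)
  rw [Nat.sub_self, Nat.le_zero, Finset.card_eq_zero] at h1
  by_contra! hcon
  have : v ∈ Finset.univ.filter fun v => K ^ Fintype.card V < lam v :=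
    Finset.mem_filter.2 ⟨Finset.mem_univ v, hcon⟩
  rw [h1] at this
  exact absurd this (Finset.notMem_empty v)

/-- Raising one label does not raise the excess at any other vertex. A strict inequality at `w`
would leave room to raise `lam w`, contradicting maximality. -/
theorem excess_eq_of_isMax (hδ : 0 < δ) {lam : V → ℝ} (hlam : lam ∈ N.subsolutions P Q δ)
    (hmax : ∀ mu ∈ N.subsolutions P Q δ, ∑ v, mu v ≤ ∑ v, lam v) {w : V} (hw : w ≠ N.s) :
    N.excess (N.regFlow P Q δ lam) w = if w = N.t then N.u₀ else 0 := by
  refine le_antisymm (hlam.2.2 w hw) ?_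
  by_contra! hlt
  have hc : ContinuousAt (fun ε : ℝ => N.excess (N.regFlow P Q δ
      (Function.update lam w (lam w + ε))) w) 0 := by
    refine ((continuous_excess_regFlow P Q δ w).comp ?_).continuousAt
    exact continuous_const.update w (by fun_prop)
  have hev : ∀ᶠ ε in nhdsWithin (0 : ℝ) (Set.Ioi 0), N.excess (N.regFlow P Q δ
      (Function.update lam w (lam w + ε))) w < if w = N.t then N.u₀ else 0 := by
    refine nhdsWithin_le_nhds (hc.eventually_lt continuousAt_const ?_)
    simpa using hlt
  obtain ⟨ε, hε, hεpos⟩ := (hev.and self_mem_nhdsWithin).exists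
  have hεpos : 0 < ε := hεpos
  set mu : V → ℝ := Function.update lam w (lam w + ε) with hmu
  have hmuw : mu w = lam w + ε := by simp [hmu]
  have hmune : ∀ u, u ≠ w → mu u = lam u := fun u hu => by simp [hmu, hu]
  have hle : ∀ u, lam u ≤ mu u := by
    intro u
    by_cases hu : u = w
    · rw [hu, hmuw]
      linarith
    · rw [hmune u hu]
  have h0 := hlam.1
  have hmem : mu ∈ N.subsolutions P Q δ := by
    refine ⟨fun v => (h0 v).trans (hle v), ?_, fun u hu => ?_⟩
    · rw [hmune _ hw.symm]
      exact hlam.2.1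
    · by_cases huw : u = w
      · rw [huw]
        exact hε.le
      · refine le_trans ?_ (hlam.2.2 u hu)
        refine sub_le_sub (Finset.sum_le_sum fun e he => ?_) (Finset.sum_le_sum fun e he => ?_)
        · have he' := (Finset.mem_filter.1 he).2
          rw [regFlow, regFlow, he', hmune u huw]
          exact arcFlow_anti_tail hδ (h0 u) (hle _)
        · have he' := (Finset.mem_filter.1 he).2
          rw [regFlow, regFlow, he', hmune u huw]
          exact arcFlow_mono_head hδ (h0 _) (hle _)
  have hsum : ∑ v, lam v < ∑ v, mu v :=
    Finset.sum_lt_sum (fun v _ => hle v) ⟨w, Finset.mem_univ w, by rw [hmuw]; linarith⟩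
  exact absurd (hmax mu hmem) (not_le.2 hsum)

theorem isStaticFlow_of_excess {x : E → ℝ} (h0 : ∀ e, 0 ≤ x e)
    (h : ∀ w, w ≠ N.s → N.excess x w = if w = N.t then N.u₀ else 0) : N.IsStaticFlow x := by
  refine ⟨h0, fun v => ?_⟩
  have h1 : (∑ e with N.src e = v, x e) - (∑ e with N.tgt e = v, x e) = -N.excess x v := by
    rw [excess]
    ring
  rw [h1]
  by_cases hv : v = N.s
  · rw [if_pos hv, hv]
    have h2 := sum_mul_excess (N := N) x 1
    simp only [Pi.one_apply, one_mul, sub_self, mul_zero, Finset.sum_const_zero] at h2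
    rw [← Finset.add_sum_erase _ _ (Finset.mem_univ N.s),
      Finset.sum_congr rfl fun w hw => h w (Finset.ne_of_mem_erase hw)] at h2
    have h3 : ∑ w ∈ Finset.univ.erase N.s, (if w = N.t then N.u₀ else 0) = N.u₀ := by
      rw [Finset.sum_ite_eq', if_pos (Finset.mem_erase.2 ⟨N.s_ne_t.symm, Finset.mem_univ _⟩)]
    linarith
  · rw [if_neg hv, h v hv]
    split_ifs <;> simp

end Regularization

end FlowNetwork

namespace FlowNetwork

/-! ### Existence of thin flows -/

section Existence

variable {V E : Type*} [Fintype V] [Fintype E] {N : FlowNetwork V E} {P Q : Set E} {δ : ℝ}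

theorem regFlow_pos (hδ : 0 < δ) {lam : V → ℝ} (h0 : ∀ v, 0 ≤ lam v) {e : E} (he : e ∈ P)
    (hlt : lam (N.src e) < lam (N.tgt e)) : 0 < N.regFlow P Q δ lam e := by
  have h1 := mul_pos (N.ν_pos e) ((h0 _).trans_lt hlt)
  rw [regFlow, arcFlow, if_pos he]
  split_ifs
  · rwa [mul_one]
  · exact mul_pos h1 (ramp_pos hδ (sub_pos.2 hlt))

theorem regFlow_eq_zero (hδ : 0 < δ) {lam : V → ℝ} {e : E} (he : e ∉ Q)
    (hle : lam (N.tgt e) ≤ lam (N.src e)) : N.regFlow P Q δ lam e = 0 := by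
  rw [regFlow, arcFlow, if_neg he, ramp_eq_zero hδ (sub_nonpos.2 hle), mul_zero, ite_self]

theorem regFlow_reset (hQP : Q ⊆ P) {lam : V → ℝ} {e : E} (he : e ∈ Q) :
    N.regFlow P Q δ lam e = N.ν e * lam (N.tgt e) := by
  rw [regFlow, arcFlow, if_pos (hQP he), if_pos he, mul_one]

theorem regFlow_eq (hδ : 0 < δ) {lam : V → ℝ} {e : E} (he : e ∈ P)
    (hlt : δ ≤ lam (N.tgt e) - lam (N.src e)) :
    N.regFlow P Q δ lam e = N.ν e * lam (N.tgt e) := by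
  rw [regFlow, arcFlow, if_pos he, ramp_eq_one hδ hlt, ite_self, mul_one]

variable [DecidableEq V]

/-- No flow touches a set of vertices that misses the source and that has no supporting arc
entering it. -/
theorem IsStaticFlow.eq_zero_of_cut {x : E → ℝ} {lam p : V → ℝ} (hx : N.IsStaticFlow x)
    (hsupp : ∀ e ∉ P, x e = 0) (hp : ∀ e ∈ P, p (N.src e) ≤ p (N.tgt e))
    (hpQ : ∀ e ∈ Q, p (N.src e) < p (N.tgt e))
    (hlamx : ∀ e ∉ Q, lam (N.tgt e) ≤ lam (N.src e) → x e = 0)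
    {W : Set V} (hs : N.s ∉ W) (hcut : ∀ e, N.src e ∉ W → N.tgt e ∈ W → x e = 0) :
    ∀ e, (N.src e ∈ W ∨ N.tgt e ∈ W) → x e = 0 := by
  classical
  have ht0 : ∀ e, 0 ≤ x e * (W.indicator (1 : V → ℝ) (N.src e) -
      W.indicator (1 : V → ℝ) (N.tgt e)) := by
    intro e
    by_cases h1 : N.src e ∈ W
    · rw [Set.indicator_of_mem h1]
      have : W.indicator (1 : V → ℝ) (N.tgt e) ≤ 1 := Set.indicator_le_self' (by simp) _
      exact mul_nonneg (hx.1 e) (sub_nonneg.2 this)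
    · by_cases h2 : N.tgt e ∈ W
      · rw [hcut e h1 h2, zero_mul]
      · rw [Set.indicator_of_notMem h1, Set.indicator_of_notMem h2, sub_self, mul_zero]
  have h1 := hx.sum_mul_sub (W.indicator (1 : V → ℝ))
  have h2 : ∑ e, x e * (W.indicator (1 : V → ℝ) (N.tgt e) - W.indicator (1 : V → ℝ) (N.src e)) =
      -∑ e, x e * (W.indicator (1 : V → ℝ) (N.src e) - W.indicator (1 : V → ℝ) (N.tgt e)) := by
    rw [← Finset.sum_neg_distrib]
    exact Finset.sum_congr rfl fun e _ => by ring
  have hsum := Finset.sum_nonneg fun e (_ : e ∈ Finset.univ) => ht0 e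
  rw [h2, Set.indicator_of_notMem hs, sub_zero] at h1
  have ht : N.t ∉ W := by
    intro ht
    rw [Set.indicator_of_mem ht, Pi.one_apply, mul_one] at h1
    linarith [N.u₀_pos]
  rw [Set.indicator_of_notMem ht, mul_zero, neg_eq_zero,
    Finset.sum_eq_zero_iff_of_nonneg fun e _ => ht0 e] at h1
  have hout : ∀ e, N.src e ∈ W → N.tgt e ∉ W → x e = 0 := by
    intro e h3 h4
    have := h1 e (Finset.mem_univ e)
    rwa [Set.indicator_of_mem h3, Set.indicator_of_notMem h4, Pi.one_apply, sub_zero,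
      mul_one] at this
  -- Nothing crosses the boundary of `W`, so inside `W` the flow is a circulation, and it cannot use
  -- arcs along which a potential increases if it never decreases. Applied to `p` this clears `Q`;
  -- applied to `lam` it then clears the rest.
  have hin : ∀ f : V → ℝ, (∀ e, N.src e ∈ W → N.tgt e ∈ W → 0 ≤ x e * (f (N.tgt e) - f (N.src e))) →
      ∀ e, N.src e ∈ W → N.tgt e ∈ W → x e * (f (N.tgt e) - f (N.src e)) = 0 := by
    intro f hf e h3 h4
    have h5 := hx.sum_mul_sub (W.indicator f)
    rw [Set.indicator_of_notMem hs, Set.indicator_of_notMem ht, sub_self, mul_zero,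
      Finset.sum_eq_zero_iff_of_nonneg] at h5
    · have := h5 e (Finset.mem_univ e)
      rwa [Set.indicator_of_mem h3, Set.indicator_of_mem h4] at this
    · intro e _
      by_cases h6 : N.src e ∈ W <;> by_cases h7 : N.tgt e ∈ W
      · rw [Set.indicator_of_mem h6, Set.indicator_of_mem h7]
        exact hf e h6 h7
      · rw [hout e h6 h7, zero_mul]
      · rw [hcut e h6 h7, zero_mul]
      · rw [Set.indicator_of_notMem h6, Set.indicator_of_notMem h7, sub_self, mul_zero]
  have hpx : ∀ e, N.src e ∈ W → N.tgt e ∈ W → 0 ≤ x e * (p (N.tgt e) - p (N.src e)) := by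
    intro e _ _
    by_cases he : e ∈ P
    · exact mul_nonneg (hx.1 e) (sub_nonneg.2 (hp e he))
    · rw [hsupp e he, zero_mul]
  have hQ : ∀ e ∈ Q, N.src e ∈ W → N.tgt e ∈ W → x e = 0 := by
    intro e he h3 h4
    exact (mul_eq_zero.1 (hin p hpx e h3 h4)).resolve_right (sub_pos.2 (hpQ e he)).ne'
  have hl : ∀ e, N.src e ∈ W → N.tgt e ∈ W → x e = 0 := by
    intro e h3 h4
    by_cases he : e ∈ Q
    · exact hQ e he h3 h4
    · refine (mul_eq_zero.1 (hin lam (fun e' h6 h7 => ?_) e h3 h4)).elim id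
        fun h => hlamx e he (sub_eq_zero.1 h).le
      by_cases he' : e' ∈ Q
      · rw [hQ e' he' h6 h7, zero_mul]
      · rcases le_total (lam (N.tgt e')) (lam (N.src e')) with h8 | h8
        · rw [hlamx e' he' h8, zero_mul]
        · exact mul_nonneg (hx.1 e') (sub_nonneg.2 h8)
  intro e he
  by_cases h3 : N.src e ∈ W <;> by_cases h4 : N.tgt e ∈ W
  · exact hl e h3 h4
  · exact hout e h3 h4
  · exact hcut e h3 h4
  · exact absurd he (by tauto)

/-- No flow touches the set `W` of ungrounded vertices, and arcs of `P` entering it strictly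
decrease `lam`. All labels on `W` could be raised by a small amount without changing the flow,
contradicting maximality. -/
theorem grounded_of_isMax (hQP : Q ⊆ P) {p : V → ℝ}
    (hp : ∀ e ∈ P, p (N.src e) ≤ p (N.tgt e)) (hpQ : ∀ e ∈ Q, p (N.src e) < p (N.tgt e))
    (hreset : ∀ e ∈ Q, N.Reachable P (N.tgt e) N.t) (hδ : 0 < δ) {lam : V → ℝ}
    (hlam : lam ∈ N.subsolutions P Q δ)
    (hmax : ∀ mu ∈ N.subsolutions P Q δ, ∑ v, mu v ≤ ∑ v, lam v)
    (hx : N.IsStaticFlow (N.regFlow P Q δ lam)) (v : V) :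
    N.Reachable (N.supportArcs P Q lam) N.s v := by
  classical
  by_contra hv
  let W : Set V := {w | ¬ N.Reachable (N.supportArcs P Q lam) N.s w}
  have h0 := hlam.1
  have hs : N.s ∉ W := fun h => h Relation.ReflTransGen.refl
  have hnot : ∀ e, N.src e ∉ W → N.tgt e ∈ W → e ∉ N.supportArcs P Q lam := by
    intro e h1 h2 he
    exact h2 ((not_not.1 h1).tail ⟨e, he, rfl, rfl⟩)
  have hsupp : ∀ e ∉ P, N.regFlow P Q δ lam e = 0 := fun e he => by
    rw [regFlow, arcFlow, if_neg he]
  have hcross : ∀ e ∈ P, N.src e ∉ W → N.tgt e ∈ W →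
      e ∉ Q ∧ lam (N.tgt e) < lam (N.src e) := by
    intro e heP h1 h2
    have : ¬ (e ∈ Q ∨ lam (N.src e) ≤ lam (N.tgt e)) := fun h => hnot e h1 h2 ⟨heP, h⟩
    push Not at this
    exact this
  have hcut : ∀ e, N.src e ∉ W → N.tgt e ∈ W → N.regFlow P Q δ lam e = 0 := by
    intro e h1 h2
    by_cases heP : e ∈ P
    · obtain ⟨h3, h4⟩ := hcross e heP h1 h2
      exact regFlow_eq_zero hδ h3 h4.le
    · exact hsupp e heP
  have hzero := hx.eq_zero_of_cut hsupp hp hpQ (lam := lam)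
    (fun e he hle => regFlow_eq_zero hδ he hle) hs hcut
  have hQW : ∀ e ∈ Q, N.tgt e ∉ W := by
    intro e he hW
    have h1 := hzero e (Or.inr hW)
    rw [regFlow_reset hQP he] at h1
    have h2 : 0 < lam (N.tgt e) := hx.pos_of_reachable_sink hlam.2.1 h0
      (fun e => arcFlow_le (h0 _)) (fun e he hlt => regFlow_pos hδ h0 he hlt) (hreset e he)
    exact (mul_pos (N.ν_pos e) h2).ne' h1
  have hlW : ∀ e ∈ P, N.tgt e ∈ W → lam (N.tgt e) ≤ lam (N.src e) := by
    intro e he hW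
    by_contra! hlt
    exact (regFlow_pos hδ h0 he hlt).ne' (hzero e (Or.inr hW))
  obtain ⟨ε, hε, hgap⟩ := exists_pos_mul_le
    (ι := {e : E // e ∈ P ∧ N.src e ∉ W ∧ N.tgt e ∈ W})
    (fun e => lam (N.src e.1) - lam (N.tgt e.1)) (fun _ => 1)
    (fun e => sub_pos.2 (hcross e.1 e.2.1 e.2.2.1 e.2.2.2).2)
  let mu : V → ℝ := fun v => lam v + W.indicator (fun _ => ε) v
  have hmuW : ∀ v ∈ W, mu v = lam v + ε := fun v hv => by
    simp only [mu, Set.indicator_of_mem hv]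
  have hmuW' : ∀ v ∉ W, mu v = lam v := fun v hv => by
    simp only [mu, Set.indicator_of_notMem hv, add_zero]
  have hle : ∀ v, lam v ≤ mu v := fun v =>
    le_add_of_nonneg_right (Set.indicator_nonneg (fun _ _ => hε.le) v)
  have hmu0 : ∀ v, 0 ≤ mu v := fun v => (h0 v).trans (hle v)
  have hreg : N.regFlow P Q δ mu = N.regFlow P Q δ lam := by
    funext e
    by_cases heP : e ∈ P
    swap
    · rw [hsupp e heP, regFlow, arcFlow, if_neg heP]
    by_cases h2 : N.tgt e ∈ W
    · have hnQ : e ∉ Q := fun h => hQW e h h2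
      rw [hzero e (Or.inr h2)]
      refine regFlow_eq_zero hδ hnQ ?_
      by_cases h1 : N.src e ∈ W
      · rw [hmuW _ h1, hmuW _ h2]
        linarith [hlW e heP h2]
      · rw [hmuW' _ h1, hmuW _ h2]
        linarith [hgap ⟨e, heP, h1, h2⟩]
    · by_cases h1 : N.src e ∈ W
      · have h3 := hzero e (Or.inl h1)
        rw [h3]
        refine le_antisymm ?_ (arcFlow_nonneg (hmu0 _))
        rw [← h3, regFlow, regFlow, hmuW' _ h2]
        exact arcFlow_anti_tail hδ (h0 _) (hle _)
      · rw [regFlow, regFlow, hmuW' _ h2, hmuW' _ h1]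
  have hmem : mu ∈ N.subsolutions P Q δ := by
    refine ⟨hmu0, ?_, fun w hw => ?_⟩
    · rw [hmuW' _ hs]
      exact hlam.2.1
    · rw [hreg]
      exact hlam.2.2 w hw
  have hsum : ∑ v, lam v < ∑ v, mu v :=
    Finset.sum_lt_sum (fun v _ => hle v) ⟨v, Finset.mem_univ v, by rw [hmuW v hv]; linarith⟩
  exact absurd (hmax mu hmem) (not_le.2 hsum)

theorem exists_isComplementary (hQP : Q ⊆ P) (p : V → ℝ)
    (hp : ∀ e ∈ P, p (N.src e) ≤ p (N.tgt e)) (hpQ : ∀ e ∈ Q, p (N.src e) < p (N.tgt e))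
    (hreach : ∀ v, N.Reachable P N.s v) (hreset : ∀ e ∈ Q, N.Reachable P (N.tgt e) N.t) :
    ∃ x lam, N.IsComplementary P Q x lam := by
  obtain ⟨B, hB⟩ := exists_bound_subsolutions hreach
  have hmax : ∀ n : ℕ, ∃ lam ∈ N.subsolutions P Q (1 / (n + 1 : ℝ)),
      ∀ mu ∈ N.subsolutions P Q (1 / (n + 1 : ℝ)), ∑ v, mu v ≤ ∑ v, lam v := by
    intro n
    have hδ : (0 : ℝ) < 1 / (n + 1) := Nat.one_div_pos_of_nat
    have hδ1 : (1 : ℝ) / (n + 1) ≤ 1 := by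
      rw [div_le_one (by positivity)]
      linarith [n.cast_nonneg (α := ℝ)]
    have hcomp : IsCompact (N.subsolutions P Q (1 / (n + 1 : ℝ))) := by
      refine (isCompact_univ_pi fun _ : V => isCompact_Icc (a := (0 : ℝ)) (b := B)).of_isClosed_subset
        isClosed_subsolutions fun lam hlam v _ => ⟨hlam.1 v, hB Q _ hδ hδ1 lam hlam v⟩
    obtain ⟨lam, hlam, h⟩ := hcomp.exists_isMaxOn subsolutions_nonempty
      (f := fun lam => ∑ v, lam v) (by fun_prop)
    exact ⟨lam, hlam, h⟩
  choose lam hlam hlmax using hmax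
  let δ : ℕ → ℝ := fun n => 1 / (n + 1 : ℝ)
  let x : ℕ → E → ℝ := fun n => N.regFlow P Q (δ n) (lam n)
  have hδ : ∀ n, 0 < δ n := fun n => Nat.one_div_pos_of_nat
  have hδ1 : ∀ n, δ n ≤ 1 := fun n => by
    simp only [δ]
    rw [div_le_one (by positivity)]
    linarith [n.cast_nonneg (α := ℝ)]
  have hx0 : ∀ n e, 0 ≤ x n e := fun n e => arcFlow_nonneg ((hlam n).1 _)
  have hxle : ∀ n e, x n e ≤ N.ν e * lam n (N.tgt e) := fun n e => arcFlow_le ((hlam n).1 _)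
  have hflow : ∀ n, N.IsStaticFlow (x n) := fun n =>
    isStaticFlow_of_excess (hx0 n) fun w hw => excess_eq_of_isMax (hδ n) (hlam n) (hlmax n) hw
  have hgr : ∀ n v, N.Reachable (N.supportArcs P Q (lam n)) N.s v := fun n =>
    grounded_of_isMax hQP hp hpQ hreset (hδ n) (hlam n) (hlmax n) (hflow n)
  have hcomp : IsCompact ((Set.univ.pi fun _ : V => Set.Icc (0 : ℝ) B) ×ˢ
      (Set.univ.pi fun e : E => Set.Icc (0 : ℝ) (N.ν e * B))) :=
    (isCompact_univ_pi fun _ => isCompact_Icc).prod (isCompact_univ_pi fun _ => isCompact_Icc)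
  obtain ⟨⟨l, y⟩, -, φ, hφ, hlim⟩ := hcomp.tendsto_subseq (x := fun n => (lam n, x n)) fun n =>
    ⟨fun v _ => ⟨(hlam n).1 v, hB Q _ (hδ n) (hδ1 n) _ (hlam n) v⟩,
      fun e _ => ⟨hx0 n e, (hxle n e).trans (mul_le_mul_of_nonneg_left
        (hB Q _ (hδ n) (hδ1 n) _ (hlam n) _) (N.ν_pos e).le)⟩⟩
  rw [Prod.tendsto_iff, tendsto_pi_nhds, tendsto_pi_nhds] at hlim
  obtain ⟨hl, hy⟩ := hlim
  simp only [Function.comp_apply] at hl hy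
  have hδlim : Filter.Tendsto (fun n => δ (φ n)) Filter.atTop (nhds 0) :=
    (tendsto_one_div_add_atTop_nhds_zero_nat (𝕜 := ℝ)).comp hφ.tendsto_atTop
  have hνl : ∀ e, Filter.Tendsto (fun n => N.ν e * lam (φ n) (N.tgt e)) Filter.atTop
      (nhds (N.ν e * l (N.tgt e))) := fun e => (hl _).const_mul _
  have heq : ∀ (e : E) (c : ℕ → ℝ), (∀ᶠ n in Filter.atTop, x (φ n) e = c (φ n)) → ∀ z,
      Filter.Tendsto (fun n => c (φ n)) Filter.atTop (nhds z) → y e = z := by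
    intro e c h z hz
    exact tendsto_nhds_unique ((hy e).congr' h) hz
  refine ⟨y, l, ⟨fun e => ge_of_tendsto' (hy e) fun n => hx0 _ e, fun v => ?_⟩, ?_, ?_, ?_, ?_, ?_,
    ?_, ?_, ?_⟩
  · have h1 : Filter.Tendsto (fun n => (∑ e with N.src e = v, x (φ n) e) -
        ∑ e with N.tgt e = v, x (φ n) e) Filter.atTop
        (nhds ((∑ e with N.src e = v, y e) - ∑ e with N.tgt e = v, y e)) :=
      (tendsto_finsetSum _ fun e _ => hy e).sub (tendsto_finsetSum _ fun e _ => hy e)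
    simp only [(hflow _).2 v] at h1
    exact tendsto_nhds_unique h1 tendsto_const_nhds
  · intro e he
    refine heq e (fun _ => 0) (Filter.Eventually.of_forall fun n => ?_) 0 tendsto_const_nhds
    simp only [x, regFlow, arcFlow, if_neg he]
  · refine tendsto_nhds_unique (hl N.s) ?_
    simp only [(hlam _).2.1]
    exact tendsto_const_nhds
  · exact fun v => ge_of_tendsto' (hl v) fun n => (hlam _).1 v
  · intro e he
    exact heq e (fun n => N.ν e * lam n (N.tgt e))
      (Filter.Eventually.of_forall fun n => regFlow_reset hQP he) _ (hνl e)
  · exact fun e => le_of_tendsto_of_tendsto' (hy e) (hνl e) fun n => hxle _ e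
  · intro e he hlt
    refine heq e (fun n => N.ν e * lam n (N.tgt e)) ?_ _ (hνl e)
    have h1 := hδlim.eventually_lt ((hl (N.tgt e)).sub (hl (N.src e))) (sub_pos.2 hlt)
    filter_upwards [h1] with n hn
    exact regFlow_eq (hδ _) he hn.le
  · intro e he hlt
    refine heq e (fun _ => 0) ?_ 0 tendsto_const_nhds
    filter_upwards [(hl (N.tgt e)).eventually_lt (hl (N.src e)) hlt] with n hn
    exact regFlow_eq_zero (hδ _) he hn.le
  · intro v
    -- A strict decrease in the limit is already one for large indices, so supporting arcs of a late
    -- approximation support the limit.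
    have h1 : ∀ᶠ n in Filter.atTop, ∀ e : E, l (N.tgt e) < l (N.src e) →
        lam (φ n) (N.tgt e) < lam (φ n) (N.src e) := by
      rw [Filter.eventually_all]
      intro e
      by_cases hlt : l (N.tgt e) < l (N.src e)
      · filter_upwards [(hl (N.tgt e)).eventually_lt (hl (N.src e)) hlt] with n hn _ using hn
      · exact Filter.Eventually.of_forall fun n h => absurd h hlt
    obtain ⟨n, hn⟩ := h1.exists
    refine (hgr (φ n) v).mono_arcs fun e he => ⟨he.1, he.2.imp_right fun h => ?_⟩
    by_contra! hlt
    exact absurd h (not_le.2 (hn e hlt))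

/-- Thin flows exist. -/
theorem exists_isThinFlow {l : V → ℝ} (hl : l ∈ N.feasibleLabellings) :
    ∃ x lam, N.IsThinFlow (N.activeArcs l) (N.resettingArcs l) x lam := by
  have h := isFeasibleConfig_of_mem hl
  obtain ⟨x, lam, hx⟩ := exists_isComplementary h.subset l
    (fun e he => le_trans (le_add_of_nonneg_right (N.τ_nonneg e)) he)
    (fun e he => lt_of_le_of_lt (le_add_of_nonneg_right (N.τ_nonneg e)) he) h.reachable h.reset
  exact ⟨x, lam, hx.isThinFlow⟩

/-- This system, on a possibly cyclic arc set, provides the candidate for the final direction of a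
trajectory. -/
theorem exists_isComplementary_univ {l : V → ℝ} (hl : l ∈ N.feasibleLabellings) :
    ∃ x lam, N.IsComplementary Set.univ ∅ x lam :=
  exists_isComplementary (Set.empty_subset _) 0 (fun _ _ => le_rfl) (fun _ he => he.elim)
    (fun v => (hl.1 v).mono_arcs (Set.subset_univ _)) (fun _ he => he.elim)

end Existence

end FlowNetwork

/-! ### Absolutely continuous functions and induction on the half-line -/

section Analysis

open MeasureTheory Set Filter Topology

theorem LipschitzWith.comp_absolutelyContinuousOnInterval {X Y : Type*} [PseudoMetricSpace X]
    [PseudoMetricSpace Y] {φ : X → Y} {K : ℝ≥0} (hφ : LipschitzWith K φ) {f : ℝ → X} {a b : ℝ}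
    (hf : AbsolutelyContinuousOnInterval f a b) :
    AbsolutelyContinuousOnInterval (fun θ => φ (f θ)) a b := by
  have h : Tendsto (fun E : ℕ × (ℕ → ℝ × ℝ) =>
      K * ∑ i ∈ Finset.range E.1, dist (f (E.2 i).1) (f (E.2 i).2))
      (AbsolutelyContinuousOnInterval.totalLengthFilter ⊓
        𝓟 (AbsolutelyContinuousOnInterval.disjWithin a b)) (𝓝 0) := by
    simpa using Tendsto.const_mul (K : ℝ) hf
  refine squeeze_zero (fun E => Finset.sum_nonneg fun _ _ => dist_nonneg) (fun E => ?_) h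
  rw [Finset.mul_sum]
  exact Finset.sum_le_sum fun i _ => hφ.dist_le_mul _ _

theorem AbsolutelyContinuousOnInterval.eval {ι : Type*} [Fintype ι] {f : ℝ → ι → ℝ} {a b : ℝ}
    (hf : AbsolutelyContinuousOnInterval f a b) (i : ι) :
    AbsolutelyContinuousOnInterval (fun θ => f θ i) a b :=
  LipschitzWith.comp_absolutelyContinuousOnInterval (φ := fun y : ι → ℝ => y i)
    (LipschitzWith.eval i) hf

theorem absolutelyContinuousOnInterval_mul (k a b : ℝ) :
    AbsolutelyContinuousOnInterval (fun η : ℝ => k * η) a b :=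
  (LipschitzWith.of_dist_le_mul (K := ‖k‖₊) fun x y => by
    rw [Real.dist_eq, Real.dist_eq, ← mul_sub, abs_mul]
    rfl).lipschitzOnWith.absolutelyContinuousOnInterval

theorem AbsolutelyContinuousOnInterval.le_of_ae_hasDerivAt_nonneg {g : ℝ → ℝ} {a b : ℝ}
    (hab : a ≤ b) (hg : AbsolutelyContinuousOnInterval g a b)
    (h : ∀ᵐ θ : ℝ, θ ∈ Ioo a b → ∃ d, 0 ≤ d ∧ HasDerivAt g d θ) : g a ≤ g b := by
  rw [← sub_nonneg, ← hg.integral_deriv_eq_sub]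
  refine intervalIntegral.integral_nonneg_of_ae_restrict hab ?_
  rw [EventuallyLE, Measure.restrict_congr_set Ioo_ae_eq_Icc.symm,
    ae_restrict_iff' measurableSet_Ioo]
  filter_upwards [h] with θ hθ hmem
  obtain ⟨d, hd, hder⟩ := hθ hmem
  rw [hder.deriv]
  exact hd

/-- A function vanishes with a nonzero derivative at countably many points only. -/
theorem countable_zero_hasDerivAt_ne_zero (q : ℝ → ℝ) :
    {θ | q θ = 0 ∧ ∃ d ≠ 0, HasDerivAt q d θ}.Countable := by
  refine (countable_setOfPred_isolated_right_within (s := {θ | q θ = 0})).mono ?_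
  rintro θ ⟨h0, d, hd, hder⟩
  refine ⟨h0, ?_⟩
  have h1 : ∀ᶠ z in 𝓝[≠] θ, q z ≠ 0 := hder.eventually_ne hd
  rw [← Filter.empty_mem_iff_bot]
  have h2 : 𝓝[{θ | q θ = 0} ∩ Ioi θ] θ ≤ 𝓝[≠] θ :=
    nhdsWithin_mono _ fun z hz => ne_of_gt hz.2
  filter_upwards [h2 h1, self_mem_nhdsWithin] with z hz hz'
  exact hz hz'.1

/-- The kink at zero is harmless if `q` has derivative zero there, which along trajectories holds
almost everywhere because zeros with nonzero derivative are countable. -/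
theorem HasDerivAt.min_sub_max_zero {q : ℝ → ℝ} {d θ : ℝ} (hq : HasDerivAt q d θ)
    (h0 : q θ = 0 → d = 0) (α β : ℝ) :
    HasDerivAt (fun ξ => α * min (q ξ) 0 - β * max (q ξ) 0)
      (((if 0 ≤ q θ then 0 else α) - (if 0 < q θ then β else 0)) * d) θ := by
  rcases lt_trichotomy (q θ) 0 with h | h | h
  · rw [if_neg (not_le.2 h), if_neg (not_lt.2 h.le), sub_zero]
    refine (hq.const_mul α).congr_of_eventuallyEq ?_
    filter_upwards [hq.continuousAt.eventually_lt continuousAt_const h] with ξ hξ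
    rw [min_eq_left hξ.le, max_eq_right hξ.le]
    ring
  · rw [h0 h, mul_zero]
    rw [h0 h, hasDerivAt_iff_isLittleO, h] at hq
    rw [hasDerivAt_iff_isLittleO, h]
    simp only [sub_zero, smul_zero, min_self, max_self, mul_zero] at hq ⊢
    refine Asymptotics.IsBigO.trans_isLittleO ?_ hq
    refine Asymptotics.IsBigO.of_bound (|α| + |β|) (Eventually.of_forall fun ξ => ?_)
    rw [Real.norm_eq_abs, Real.norm_eq_abs, add_mul]
    refine (abs_sub _ _).trans (add_le_add ?_ ?_)
    · rw [abs_mul]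
      refine mul_le_mul_of_nonneg_left ?_ (abs_nonneg _)
      rcases le_total (q ξ) 0 with h1 | h1
      · rw [min_eq_left h1]
      · rw [min_eq_right h1, abs_zero]
        exact abs_nonneg _
    · rw [abs_mul]
      refine mul_le_mul_of_nonneg_left ?_ (abs_nonneg _)
      rcases le_total (q ξ) 0 with h1 | h1
      · rw [max_eq_right h1, abs_zero]
        exact abs_nonneg _
      · rw [max_eq_left h1]
  · rw [if_pos h.le, if_pos h, zero_sub]
    refine (hq.const_mul (-β)).congr_of_eventuallyEq ?_
    filter_upwards [continuousAt_const.eventually_lt hq.continuousAt h] with ξ hξ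
    rw [min_eq_right hξ.le, max_eq_left hξ.le]
    ring

/-- Induction along the nonnegative reals. -/
theorem real_induction {S : ℝ → Prop} (h0 : S 0)
    (hlim : ∀ T, 0 < T → (∀ t, 0 ≤ t → t < T → S t) → S T)
    (hext : ∀ T, 0 ≤ T → S T → ∃ ε > 0, ∀ t, T ≤ t → t ≤ T + ε → S t) :
    ∀ T, 0 ≤ T → S T := by
  by_contra! hcon
  obtain ⟨T₀, hT₀, hT₀S⟩ := hcon
  let B : Set ℝ := {t | 0 ≤ t ∧ ¬ S t}
  have hB : B.Nonempty := ⟨T₀, hT₀, hT₀S⟩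
  have hbdd : BddBelow B := ⟨0, fun t ht => ht.1⟩
  have hm : 0 ≤ sInf B := le_csInf hB fun t ht => ht.1
  have hlt : ∀ t, 0 ≤ t → t < sInf B → S t := by
    intro t ht h
    by_contra hS
    exact absurd (csInf_le hbdd (show t ∈ B from ⟨ht, hS⟩)) (not_le.2 h)
  have hS : S (sInf B) := by
    rcases hm.eq_or_lt with h | h
    · rwa [← h]
    · exact hlim _ h hlt
  obtain ⟨ε, hε, h⟩ := hext _ hm hS
  obtain ⟨t, ht, hlt'⟩ := exists_lt_of_csInf_lt hB (lt_add_of_pos_right (sInf B) hε)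
  exact ht.2 (h t (csInf_le hbdd ht) hlt'.le)

end Analysis

namespace FlowNetwork

/-! ### The Lyapunov function along trajectories -/

section Dynamics

open MeasureTheory Set Filter Topology

variable {V E : Type*} [Fintype V] [Fintype E] (N : FlowNetwork V E)

/-- The amount by which an arc exceeds the threshold of being active. -/
def arcSlack (e : E) (l : V → ℝ) : ℝ := l (N.tgt e) - l (N.src e) - N.τ e

/-- The Lyapunov function. -/
noncomputable def lyapunov (α β : E → ℝ) (l : V → ℝ) : ℝ :=
  ∑ e, (α e * min (N.arcSlack e l) 0 - β e * max (N.arcSlack e l) 0)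

variable {N}

theorem mem_activeArcs {e : E} {l : V → ℝ} : e ∈ N.activeArcs l ↔ 0 ≤ N.arcSlack e l := by
  simp only [activeArcs, arcSlack, mem_ofPred_eq]
  constructor <;> intro h <;> linarith

theorem mem_resettingArcs {e : E} {l : V → ℝ} : e ∈ N.resettingArcs l ↔ 0 < N.arcSlack e l := by
  simp only [resettingArcs, arcSlack, mem_ofPred_eq]
  constructor <;> intro h <;> linarith

theorem abs_arcSlack_sub_le (e : E) (l m : V → ℝ) :
    |N.arcSlack e l - N.arcSlack e m| ≤ 2 * ‖l - m‖ := by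
  have h1 := norm_le_pi_norm (l - m) (N.tgt e)
  have h2 := norm_le_pi_norm (l - m) (N.src e)
  rw [Pi.sub_apply, Real.norm_eq_abs] at h1 h2
  have h3 : N.arcSlack e l - N.arcSlack e m =
      (l (N.tgt e) - m (N.tgt e)) - (l (N.src e) - m (N.src e)) := by
    simp only [arcSlack]
    ring
  rw [h3]
  exact (abs_sub _ _).trans (by linarith)

theorem arcSlack_add_smul (e : E) (l lam : V → ℝ) (θ : ℝ) :
    N.arcSlack e (l + θ • lam) = N.arcSlack e l + θ * (lam (N.tgt e) - lam (N.src e)) := by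
  simp only [arcSlack, Pi.add_apply, Pi.smul_apply, smul_eq_mul]
  ring

theorem lyapunov_nonpos {α β : E → ℝ} (hα : ∀ e, 0 ≤ α e) (hβ : ∀ e, 0 ≤ β e) (l : V → ℝ) :
    N.lyapunov α β l ≤ 0 :=
  Finset.sum_nonpos fun e _ => sub_nonpos.2 ((mul_nonpos_of_nonneg_of_nonpos (hα e)
    (min_le_right _ _)).trans (mul_nonneg (hβ e) (le_max_right _ _)))

theorem lipschitzWith_lyapunov (N : FlowNetwork V E) (α β : E → ℝ) :
    LipschitzWith (∑ e, (|α e| + |β e|) * 2).toNNReal (N.lyapunov α β) := by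
  refine LipschitzWith.of_dist_le_mul fun l m => ?_
  rw [Real.coe_toNNReal _ (Finset.sum_nonneg fun e _ => by positivity), Real.dist_eq, dist_eq_norm,
    lyapunov, lyapunov, ← Finset.sum_sub_distrib, Finset.sum_mul]
  refine (Finset.abs_sum_le_sum_abs _ _).trans (Finset.sum_le_sum fun e _ => ?_)
  have h := abs_arcSlack_sub_le (N := N) e l m
  have h1 : |min (N.arcSlack e l) 0 - min (N.arcSlack e m) 0| ≤ 2 * ‖l - m‖ :=
    (abs_min_sub_min_le_max _ _ _ _).trans (max_le h (by simp))
  have h2 : |max (N.arcSlack e l) 0 - max (N.arcSlack e m) 0| ≤ 2 * ‖l - m‖ :=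
    (abs_max_sub_max_le_max _ _ _ _).trans (max_le h (by simp))
  have h3 : α e * min (N.arcSlack e l) 0 - β e * max (N.arcSlack e l) 0 -
      (α e * min (N.arcSlack e m) 0 - β e * max (N.arcSlack e m) 0) =
      α e * (min (N.arcSlack e l) 0 - min (N.arcSlack e m) 0) -
      β e * (max (N.arcSlack e l) 0 - max (N.arcSlack e m) 0) := by ring
  rw [h3]
  refine (abs_sub _ _).trans ?_
  rw [abs_mul, abs_mul, mul_assoc, add_mul]
  exact add_le_add (mul_le_mul_of_nonneg_left h1 (abs_nonneg _))
    (mul_le_mul_of_nonneg_left h2 (abs_nonneg _))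

theorem lyapunov_eq_zero {α β : E → ℝ} {l : V → ℝ} (hα : ∀ e, e ∉ N.activeArcs l → α e = 0)
    (hβ : ∀ e ∈ N.resettingArcs l, β e = 0) : N.lyapunov α β l = 0 := by
  refine Finset.sum_eq_zero fun e _ => ?_
  rcases lt_trichotomy (N.arcSlack e l) 0 with h | h | h
  · rw [hα e fun h' => absurd (mem_activeArcs.1 h') (not_le.2 h), max_eq_right h.le]
    ring
  · simp [h]
  · rw [hβ e (mem_resettingArcs.2 h), min_eq_right h.le]
    ring

theorem hasDerivAt_arcSlack {f : ℝ → V → ℝ} {mu : V → ℝ} {θ : ℝ} (hf : HasDerivAt f mu θ) (e : E) :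
    HasDerivAt (fun ξ => N.arcSlack e (f ξ)) (mu (N.tgt e) - mu (N.src e)) θ := by
  rw [hasDerivAt_pi] at hf
  exact ((hf _).sub (hf _)).sub_const _

theorem hasDerivAt_lyapunov {f : ℝ → V → ℝ} {mu : V → ℝ} {θ : ℝ} (hf : HasDerivAt f mu θ)
    (htight : ∀ e ∈ N.activeArcs (f θ), e ∉ N.resettingArcs (f θ) →
      mu (N.tgt e) = mu (N.src e)) (α β : E → ℝ) :
    HasDerivAt (fun ξ => N.lyapunov α β (f ξ))
      (N.lyapunovRate α β (N.activeArcs (f θ)) (N.resettingArcs (f θ)) mu) θ := by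
  unfold lyapunov lyapunovRate
  refine HasDerivAt.fun_sum fun e _ => ?_
  have h := (hasDerivAt_arcSlack (N := N) hf e).min_sub_max_zero (fun h0 => ?_) (α e) (β e)
  · simp only [mem_activeArcs, mem_resettingArcs]
    convert! h
  · rw [htight e (mem_activeArcs.2 h0.ge) fun h' => (mem_resettingArcs.1 h').ne' h0, sub_self]

variable [DecidableEq V] (N)

/-- A common Lipschitz constant of all trajectories. -/
noncomputable def maxSpeed : ℝ≥0 := N.exists_norm_le_of_isThinFlow.choose

/-- Equilibrium trajectories on a compact time interval. -/
structure IsTrajectoryOn (f : ℝ → V → ℝ) (a b : ℝ) : Prop where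
  feasible : ∀ θ ∈ Icc a b, f θ ∈ N.feasibleLabellings
  lipschitz : LipschitzOnWith N.maxSpeed f (Icc a b)
  thinFlow : ∀ᵐ θ : ℝ, θ ∈ Ioo a b → ∃ x lam,
    N.IsThinFlow (N.activeArcs (f θ)) (N.resettingArcs (f θ)) x lam ∧ HasDerivAt f lam θ

variable {N} {f : ℝ → V → ℝ} {a b : ℝ}

theorem norm_le_maxSpeed {l : V → ℝ} (hl : l ∈ N.feasibleLabellings) {x : E → ℝ} {mu : V → ℝ}
    (h : N.IsThinFlow (N.activeArcs l) (N.resettingArcs l) x mu) : ‖mu‖ ≤ N.maxSpeed :=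
  N.exists_norm_le_of_isThinFlow.choose_spec _ _ x mu (isFeasibleConfig_of_mem hl) h

theorem IsTrajectoryOn.mono (h : N.IsTrajectoryOn f a b) {c d : ℝ} (hac : a ≤ c) (hdb : d ≤ b) :
    N.IsTrajectoryOn f c d := by
  refine ⟨fun θ hθ => h.feasible θ (Icc_subset_Icc hac hdb hθ),
    h.lipschitz.mono (Icc_subset_Icc hac hdb), ?_⟩
  filter_upwards [h.thinFlow] with θ hθ hmem using hθ (Ioo_subset_Ioo hac hdb hmem)

theorem IsTrajectoryOn.norm_sub_le (h : N.IsTrajectoryOn f a b) {θ ξ : ℝ} (hθ : θ ∈ Icc a b)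
    (hξ : ξ ∈ Icc a b) : ‖f θ - f ξ‖ ≤ N.maxSpeed * |θ - ξ| := by
  rw [← dist_eq_norm, ← Real.dist_eq]
  exact h.lipschitz.dist_le_mul θ hθ ξ hξ

theorem IsTrajectoryOn.absolutelyContinuousOnInterval (hab : a ≤ b) (h : N.IsTrajectoryOn f a b) :
    AbsolutelyContinuousOnInterval f a b := by
  refine LipschitzOnWith.absolutelyContinuousOnInterval (K := N.maxSpeed) ?_
  rw [uIcc_of_le hab]
  exact h.lipschitz

/-- The derivative is almost everywhere bounded by `maxSpeed`; absolute continuity makes each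
coordinate comparable with a linear function of that slope. -/
theorem isTrajectoryOn_of_absolutelyContinuous
    (hfeas : ∀ θ ∈ Icc a b, f θ ∈ N.feasibleLabellings)
    (hac : AbsolutelyContinuousOnInterval f a b)
    (hthin : ∀ᵐ θ : ℝ, θ ∈ Ioo a b → ∃ x lam,
      N.IsThinFlow (N.activeArcs (f θ)) (N.resettingArcs (f θ)) x lam ∧ HasDerivAt f lam θ) :
    N.IsTrajectoryOn f a b := by
  refine ⟨hfeas, ?_, hthin⟩
  have key : ∀ θ ∈ Icc a b, ∀ ξ ∈ Icc a b, θ ≤ ξ → ‖f ξ - f θ‖ ≤ N.maxSpeed * (ξ - θ) := by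
    intro θ hθ ξ hξ hle
    have hac' : AbsolutelyContinuousOnInterval f θ ξ := by
      refine hac.mono ?_
      rw [uIcc_of_le hle, uIcc_of_le (hθ.1.trans hθ.2)]
      exact Icc_subset_Icc hθ.1 hξ.2
    refine (pi_norm_le_iff_of_nonneg (mul_nonneg (NNReal.coe_nonneg _) (sub_nonneg.2 hle))).2
      fun v => ?_
    have hlin := absolutelyContinuousOnInterval_mul N.maxSpeed θ ξ
    have hv := hac'.eval v
    have hder : ∀ᵐ η : ℝ, η ∈ Ioo θ ξ → ∃ d : ℝ, |d| ≤ N.maxSpeed ∧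
        HasDerivAt (fun η => f η v) d η := by
      filter_upwards [hthin] with η hη hmem
      have hmem' : η ∈ Ioo a b := Ioo_subset_Ioo hθ.1 hξ.2 hmem
      obtain ⟨x, mu, hx, hd⟩ := hη hmem'
      refine ⟨mu v, (norm_le_pi_norm mu v).trans
        (norm_le_maxSpeed (hfeas η (Ioo_subset_Icc_self hmem')) hx), (hasDerivAt_pi.1 hd) v⟩
    have hlin' : ∀ η : ℝ, HasDerivAt (fun η : ℝ => (N.maxSpeed : ℝ) * η) N.maxSpeed η := fun η =>
      hasDerivAt_const_mul _
    have h1 := AbsolutelyContinuousOnInterval.le_of_ae_hasDerivAt_nonneg hle (hlin.fun_sub hv) (by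
      filter_upwards [hder] with η hη hmem
      obtain ⟨d, hd, hd'⟩ := hη hmem
      exact ⟨N.maxSpeed - d, sub_nonneg.2 (le_of_abs_le hd), (hlin' η).fun_sub hd'⟩)
    have h2 := AbsolutelyContinuousOnInterval.le_of_ae_hasDerivAt_nonneg hle (hlin.fun_add hv) (by
      filter_upwards [hder] with η hη hmem
      obtain ⟨d, hd, hd'⟩ := hη hmem
      exact ⟨N.maxSpeed + d, by linarith [neg_le_of_abs_le hd], (hlin' η).fun_add hd'⟩)
    rw [Pi.sub_apply, Real.norm_eq_abs, abs_le]
    constructor <;> linarith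
  refine LipschitzOnWith.of_dist_le_mul fun θ hθ ξ hξ => ?_
  rcases le_total θ ξ with h | h
  · rw [dist_comm, dist_eq_norm, dist_comm θ, Real.dist_eq, abs_of_nonneg (sub_nonneg.2 h)]
    exact key θ hθ ξ hξ h
  · rw [dist_eq_norm, Real.dist_eq, abs_of_nonneg (sub_nonneg.2 h)]
    exact key ξ hξ θ hθ h

/-- Almost everywhere, the derivative does not change the slack of a tight arc. -/
theorem IsTrajectoryOn.ae_tight (h : N.IsTrajectoryOn f a b) :
    ∀ᵐ θ : ℝ, θ ∈ Ioo a b → ∃ x mu,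
      N.IsThinFlow (N.activeArcs (f θ)) (N.resettingArcs (f θ)) x mu ∧ HasDerivAt f mu θ ∧
      ∀ e ∈ N.activeArcs (f θ), e ∉ N.resettingArcs (f θ) → mu (N.tgt e) = mu (N.src e) := by
  have h1 : ∀ᵐ θ : ℝ, ∀ e : E, ¬ (N.arcSlack e (f θ) = 0 ∧
      ∃ d ≠ 0, HasDerivAt (fun ξ => N.arcSlack e (f ξ)) d θ) := by
    rw [ae_all_iff]
    intro e
    exact (countable_zero_hasDerivAt_ne_zero fun ξ => N.arcSlack e (f ξ)).ae_notMem volume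
  filter_upwards [h.thinFlow, h1] with θ hθ hne hmem
  obtain ⟨x, mu, hx, hd⟩ := hθ hmem
  refine ⟨x, mu, hx, hd, fun e he he' => ?_⟩
  by_contra hcon
  refine hne e ⟨le_antisymm ?_ (mem_activeArcs.1 he), _, sub_ne_zero.2 hcon,
    hasDerivAt_arcSlack hd e⟩
  exact not_lt.1 fun h' => he' (mem_resettingArcs.2 h')

theorem IsTrajectoryOn.absolutelyContinuousOnInterval_lyapunov (hab : a ≤ b)
    (h : N.IsTrajectoryOn f a b) (α β : E → ℝ) :
    AbsolutelyContinuousOnInterval (fun θ => N.lyapunov α β (f θ)) a b :=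
  (N.lipschitzWith_lyapunov α β).comp_absolutelyContinuousOnInterval
    (h.absolutelyContinuousOnInterval hab)

/-- The deviation from the steady direction is controlled by the Lyapunov function. -/
theorem IsTrajectoryOn.deviation_le (hab : a ≤ b) (h : N.IsTrajectoryOn f a b) {α β : E → ℝ}
    {c : ℝ} {lam : V → ℝ} (hc : 0 ≤ c)
    (hrate : ∀ θ ∈ Ioo a b, ∀ x mu,
      N.IsThinFlow (N.activeArcs (f θ)) (N.resettingArcs (f θ)) x mu →
      (∀ e ∈ N.activeArcs (f θ), e ∉ N.resettingArcs (f θ) → mu (N.tgt e) = mu (N.src e)) →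
      c * ‖mu - lam‖ ≤ N.lyapunovRate α β (N.activeArcs (f θ)) (N.resettingArcs (f θ)) mu) :
    c * ‖f b - f a - (b - a) • lam‖ ≤ N.lyapunov α β (f b) - N.lyapunov α β (f a) := by
  have hΞ := h.absolutelyContinuousOnInterval_lyapunov hab α β
  have hv := (h.absolutelyContinuousOnInterval hab).eval
  -- Testing signed coordinates replaces integrating a norm: subtracting `σ` times the coordinate
  -- deviation leaves a function with nonnegative derivative almost everywhere.
  have key : ∀ v (σ : ℝ), |σ| ≤ c → σ * (f b v - f a v - (b - a) * lam v) ≤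
      N.lyapunov α β (f b) - N.lyapunov α β (f a) := by
    intro v σ hσ
    have hac : AbsolutelyContinuousOnInterval
        (fun η => N.lyapunov α β (f η) - (σ * f η v - σ * lam v * η)) a b :=
      hΞ.fun_sub (((hv v).const_mul σ).fun_sub
        (absolutelyContinuousOnInterval_mul (σ * lam v) a b))
    have h1 := hac.le_of_ae_hasDerivAt_nonneg hab (by
      filter_upwards [h.ae_tight] with θ hθ hmem
      obtain ⟨x, mu, hx, hd, htight⟩ := hθ hmem
      refine ⟨_, ?_, (hasDerivAt_lyapunov hd htight α β).fun_sub
        ((((hasDerivAt_pi.1 hd) v).const_mul σ).fun_sub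
          (hasDerivAt_const_mul (σ * lam v)))⟩
      have h2 := hrate θ hmem x mu hx htight
      have h3 : σ * (mu v - lam v) ≤ c * ‖mu - lam‖ := by
        refine (le_abs_self _).trans ?_
        rw [abs_mul]
        exact mul_le_mul hσ (norm_le_pi_norm (mu - lam) v) (abs_nonneg _) hc
      linarith)
    linarith
  have hnn : 0 ≤ N.lyapunov α β (f b) - N.lyapunov α β (f a) := by
    simpa using key N.s 0 (by simpa using hc)
  rcases hc.eq_or_lt with h0 | hcpos
  · rw [← h0, zero_mul]
    exact hnn
  rw [← le_div_iff₀' hcpos]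
  refine (pi_norm_le_iff_of_nonneg (div_nonneg hnn hc)).2 fun v => ?_
  rw [le_div_iff₀' hcpos, Real.norm_eq_abs]
  simp only [Pi.sub_apply, Pi.smul_apply, smul_eq_mul]
  rcases le_total 0 (f b v - f a v - (b - a) * lam v) with h1 | h1
  · rw [abs_of_nonneg h1]
    exact key v c (abs_of_nonneg hc).le
  · rw [abs_of_nonpos h1]
    have := key v (-c) (by rw [abs_neg, abs_of_nonneg hc])
    linarith

/-- Near a labelling with a given steady direction, trajectories follow this direction. -/
theorem exists_local_estimate {l₀ : V → ℝ} (hl₀ : l₀ ∈ N.feasibleLabellings) {x : E → ℝ}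
    {lam : V → ℝ} (hx : N.IsThinFlow (N.activeArcs l₀) (N.resettingArcs l₀) x lam) :
    ∃ C : ℝ, 0 ≤ C ∧ ∀ (f : ℝ → V → ℝ) (a b : ℝ), a ≤ b → N.IsTrajectoryOn f a b →
      (∀ θ ∈ Ioo a b, N.resettingArcs l₀ ⊆ N.resettingArcs (f θ) ∧
        N.activeArcs (f θ) ⊆ N.activeArcs l₀) →
      ‖f b - f a - (b - a) • lam‖ ≤ C * ‖f a - l₀‖ := by
  have hA := isFeasibleConfig_of_mem hl₀
  obtain ⟨α, β, c, hα, hβ, hα0, hβ0, hc, hrate⟩ := exists_lyapunov (hx.isComplementary hA)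
    (hx.pos hA)
  let K := (∑ e, (|α e| + |β e|) * 2).toNNReal
  refine ⟨K / c, by positivity, fun f a b hab h hcfg => ?_⟩
  have h1 := h.deviation_le hab (α := α) (β := β) (lam := lam) hc.le
    fun θ hθ x' mu hx' htight => hrate _ _ x' mu
      (isFeasibleConfig_of_mem (h.feasible θ (Ioo_subset_Icc_self hθ))) hx' (hcfg θ hθ).1
      (hcfg θ hθ).2 htight
  -- The Lyapunov function is zero at `l₀` and never positive, so its total increase is at most its
  -- initial deficit, a Lipschitz multiple of `‖f a - l₀‖`.
  have h2 := lyapunov_nonpos (N := N) hα hβ (f b)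
  have h3 := (N.lipschitzWith_lyapunov α β).dist_le_mul (f a) l₀
  rw [lyapunov_eq_zero hα0 hβ0, Real.dist_eq, sub_zero, dist_eq_norm] at h3
  rw [div_mul_eq_mul_div, le_div_iff₀' hc]
  have h4 := neg_abs_le (N.lyapunov α β (f a))
  change _ ≤ (K : ℝ) * _ at h3
  linarith

end Dynamics

end FlowNetwork

namespace FlowNetwork

/-! ### Existence, uniqueness and dependence on compact intervals -/

section Existence

open MeasureTheory Set Filter Topology

variable {V E : Type*} [Fintype V] [Fintype E] {N : FlowNetwork V E}

/-- Stability of configurations under small perturbations and along directions that do not shrink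
the slacks. -/
theorem exists_config_stable (N : FlowNetwork V E) (l₀ : V → ℝ) :
    ∃ ρ > 0, ∀ (lam : V → ℝ) (s : ℝ) (l : V → ℝ), 0 ≤ s →
      (∀ e, 0 < N.arcSlack e l₀ → lam (N.src e) ≤ lam (N.tgt e)) →
      (∀ e, N.arcSlack e l₀ < 0 → lam (N.tgt e) ≤ lam (N.src e)) →
      ‖l - (l₀ + s • lam)‖ < ρ →
      N.resettingArcs l₀ ⊆ N.resettingArcs l ∧ N.activeArcs l ⊆ N.activeArcs l₀ := by
  obtain ⟨ρ, hρ, h⟩ := exists_pos_mul_le (ι := {e : E // N.arcSlack e l₀ ≠ 0})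
    (fun e => |N.arcSlack e.1 l₀|) (fun _ => 2) (fun e => abs_pos.2 e.2)
  refine ⟨ρ, hρ, fun lam s l hs hpos hneg hl => ⟨fun e he => ?_, fun e he => ?_⟩⟩
  · rw [mem_resettingArcs] at he ⊢
    have h1 := h ⟨e, he.ne'⟩
    have h2 := abs_arcSlack_sub_le (N := N) e l (l₀ + s • lam)
    rw [arcSlack_add_smul, abs_le] at h2
    rw [abs_of_pos he] at h1
    have h3 := mul_nonneg hs (sub_nonneg.2 (hpos e he))
    linarith [h2.1]
  · rw [mem_activeArcs] at he ⊢
    by_contra! hlt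
    have h1 := h ⟨e, hlt.ne⟩
    have h2 := abs_arcSlack_sub_le (N := N) e l (l₀ + s • lam)
    rw [arcSlack_add_smul, abs_le] at h2
    rw [abs_of_neg hlt] at h1
    have h3 := mul_nonneg hs (sub_nonneg.2 (hneg e hlt))
    linarith [h2.2]

theorem exists_config_near (N : FlowNetwork V E) (l₀ : V → ℝ) :
    ∃ ρ > 0, ∀ l : V → ℝ, ‖l - l₀‖ < ρ →
      N.resettingArcs l₀ ⊆ N.resettingArcs l ∧ N.activeArcs l ⊆ N.activeArcs l₀ := by
  obtain ⟨ρ, hρ, h⟩ := N.exists_config_stable l₀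
  exact ⟨ρ, hρ, fun l hl => h 0 0 l le_rfl (fun _ _ => le_rfl) (fun _ _ => le_rfl) (by simpa using hl)⟩

/-- Near `l`, labellings have at most its active arcs and at least its resetting arcs, so
feasibility of a close labelling passes to `l`. -/
theorem isClosed_feasibleLabellings (N : FlowNetwork V E) : IsClosed N.feasibleLabellings := by
  refine isClosed_of_closure_subset fun l hl => ?_
  obtain ⟨ρ, hρ, h⟩ := N.exists_config_near l
  obtain ⟨m, hm, hdist⟩ := Metric.mem_closure_iff.1 hl ρ hρ
  obtain ⟨hR, hA⟩ := h m (by rwa [← dist_eq_norm, dist_comm])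
  exact ⟨fun v => (hm.1 v).mono_arcs hA, fun e he =>
    ⟨(hm.2 e (hR he)).1.mono_arcs hA, (hm.2 e (hR he)).2.mono_arcs hA⟩⟩

theorem isOpen_config_subset (N : FlowNetwork V E) (Q P : Set E) :
    IsOpen {l | Q ⊆ N.resettingArcs l ∧ N.activeArcs l ⊆ P} := by
  rw [isOpen_iff_mem_nhds]
  intro l hl
  obtain ⟨ρ, hρ, h⟩ := N.exists_config_near l
  filter_upwards [Metric.ball_mem_nhds l hρ] with m hm
  obtain ⟨hR, hA⟩ := h m (by rwa [← dist_eq_norm])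
  exact ⟨hl.1.trans hR, hA.trans hl.2⟩

variable [DecidableEq V]

theorem IsComplementary.reachable_sink {A R : Set E} {x : E → ℝ} {lam : V → ℝ}
    (hwf : WellFounded (N.Adj A)) (h : N.IsComplementary A R x lam) {e : E}
    (he : 0 < x e) : N.Reachable (N.supportArcs A R lam) (N.tgt e) N.t := by
  have hsupp : ∀ e, 0 < x e → e ∈ N.supportArcs A R lam := by
    intro e he
    refine ⟨by_contra fun h' => he.ne' (h.support e h'), ?_⟩
    by_contra! hcon
    exact he.ne' (h.down e hcon.1 hcon.2)
  let r : V → V → Prop := fun a b => Relation.TransGen (N.Adj A) b a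
  have : Std.Irrefl r := ⟨fun a => hwf.transGen.irrefl.irrefl a⟩
  have : IsTrans V r := ⟨fun a b c hab hbc => hbc.trans hab⟩
  have hwf' : WellFounded r := Finite.wellFounded_of_trans_of_irrefl r
  suffices H : ∀ w e, N.tgt e = w → 0 < x e → N.Reachable (N.supportArcs A R lam) w N.t from
    H _ e rfl he
  intro w
  induction w using hwf'.induction with
  | _ w ih =>
    rintro e rfl he
    by_cases ht : N.tgt e = N.t
    · rw [ht]
      exact Relation.ReflTransGen.refl
    · obtain ⟨e', hsrc, he'⟩ := h.flow.exists_pos_of_pos_in he ht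
      have hmem := hsupp e' he'
      exact Relation.ReflTransGen.head ⟨e', hmem, hsrc, rfl⟩
        (ih (N.tgt e') (Relation.TransGen.single ⟨e', hmem.1, hsrc, rfl⟩) e' rfl he')

/-- Following the thin flow direction, the configuration changes at once and then remains constant
for some time. -/
theorem exists_config_linear {l₀ : V → ℝ} (hl₀ : l₀ ∈ N.feasibleLabellings) {x : E → ℝ}
    {lam : V → ℝ} (hx : N.IsThinFlow (N.activeArcs l₀) (N.resettingArcs l₀) x lam) :
    ∃ ε > 0, ∀ s : ℝ, 0 < s → s ≤ ε →
      N.activeArcs (l₀ + s • lam) =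
        N.supportArcs (N.activeArcs l₀) (N.resettingArcs l₀) lam ∧
      N.resettingArcs (l₀ + s • lam) =
        N.queueingArcs (N.activeArcs l₀) (N.resettingArcs l₀) lam := by
  obtain ⟨ρ, hρ, hnear⟩ := N.exists_config_near l₀
  have hK := norm_le_maxSpeed hl₀ hx
  have hK0 := N.maxSpeed.coe_nonneg
  refine ⟨ρ / (N.maxSpeed + 1), by positivity, fun s hs hsε => ?_⟩
  obtain ⟨hR, hA⟩ := hnear (l₀ + s • lam) (by
    rw [add_sub_cancel_left, norm_smul, Real.norm_of_nonneg hs.le]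
    rw [le_div_iff₀ (by positivity)] at hsε
    calc s * ‖lam‖ ≤ s * N.maxSpeed := mul_le_mul_of_nonneg_left hK hs.le
      _ < s * (N.maxSpeed + 1) := mul_lt_mul_of_pos_left (by linarith) hs
      _ ≤ ρ := hsε)
  constructor
  · ext e
    constructor
    · intro he
      refine ⟨hA he, ?_⟩
      by_cases heR : e ∈ N.resettingArcs l₀
      · exact Or.inl heR
      · right
        rw [mem_resettingArcs] at heR
        rw [mem_activeArcs, arcSlack_add_smul] at he
        have : 0 ≤ s * (lam (N.tgt e) - lam (N.src e)) := by linarith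
        exact sub_nonneg.1 (nonneg_of_mul_nonneg_right this hs)
    · rintro ⟨heA, heR | hle⟩
      · exact N.resettingArcs_subset _ (hR heR)
      · rw [mem_activeArcs] at heA
        rw [mem_activeArcs, arcSlack_add_smul]
        exact add_nonneg heA (mul_nonneg hs.le (sub_nonneg.2 hle))
  · ext e
    constructor
    · intro he
      refine ⟨hA (N.resettingArcs_subset _ he), ?_⟩
      by_cases heR : e ∈ N.resettingArcs l₀
      · exact Or.inl heR
      · right
        rw [mem_resettingArcs] at heR
        rw [mem_resettingArcs, arcSlack_add_smul] at he
        have : 0 < s * (lam (N.tgt e) - lam (N.src e)) := by linarith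
        exact sub_pos.1 (pos_of_mul_pos_right this hs.le)
    · rintro ⟨heA, heR | hle⟩
      · exact hR heR
      · rw [mem_activeArcs] at heA
        rw [mem_resettingArcs, arcSlack_add_smul]
        exact add_pos_of_nonneg_of_pos heA (mul_pos hs (sub_pos.2 hle))

/-- Just after departure the configuration is constant and the same thin flow fits it. Grounding
gives reachability from the source, and queueing arcs carry flow, hence lead on to the sink. -/
theorem exists_linear_trajectory {l₀ : V → ℝ} (hl₀ : l₀ ∈ N.feasibleLabellings) :
    ∃ lam : V → ℝ, ∃ ε > 0, ∀ a, N.IsTrajectoryOn (fun θ => l₀ + (θ - a) • lam) a (a + ε) := by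
  obtain ⟨x, lam, hx⟩ := exists_isThinFlow hl₀
  have hcfg := isFeasibleConfig_of_mem hl₀
  have hc := hx.isComplementary hcfg
  obtain ⟨ε, hε, h⟩ := exists_config_linear hl₀ hx
  refine ⟨lam, ε, hε, fun a => ⟨fun θ hθ => ?_, ?_, ?_⟩⟩
  · rcases hθ.1.eq_or_lt with h0 | h0
    · rw [← h0, sub_self, zero_smul, add_zero]
      exact hl₀
    · obtain ⟨hA, hR⟩ := h (θ - a) (sub_pos.2 h0) (by linarith [hθ.2])
      refine ⟨fun v => hA ▸ hc.grounded v, fun e he => ?_⟩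
      rw [hA]
      refine ⟨hc.grounded _, hc.reachable_sink hcfg.wf ?_⟩
      rw [hR] at he
      rw [hc.refine.reset e he]
      exact mul_pos (N.ν_pos e) (hx.pos hcfg _)
  · refine LipschitzOnWith.of_dist_le_mul fun θ _ ξ _ => ?_
    rw [dist_eq_norm, Real.dist_eq, add_sub_add_left_eq_sub, ← sub_smul, sub_sub_sub_cancel_right,
      norm_smul, Real.norm_eq_abs, mul_comm]
    exact mul_le_mul_of_nonneg_right (norm_le_maxSpeed hl₀ hx) (abs_nonneg _)
  · refine Eventually.of_forall fun θ hθ => ⟨x, lam, ?_, ?_⟩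
    · obtain ⟨hA, hR⟩ := h (θ - a) (sub_pos.2 hθ.1) (by linarith [hθ.2])
      rw [hA, hR]
      exact hc.refine.isThinFlow
    · simpa using (((hasDerivAt_id θ).sub_const a).smul_const lam).const_add l₀

variable {f g : ℝ → V → ℝ} {a b c : ℝ}

theorem IsTrajectoryOn.congr (hf : N.IsTrajectoryOn f a b) (h : EqOn f g (Icc a b)) :
    N.IsTrajectoryOn g a b := by
  refine ⟨fun θ hθ => h hθ ▸ hf.feasible θ hθ, fun θ hθ ξ hξ => ?_, ?_⟩
  · rw [← h hθ, ← h hξ]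
    exact hf.lipschitz hθ hξ
  · filter_upwards [hf.thinFlow] with θ hθ hmem
    obtain ⟨x, mu, hx, hd⟩ := hθ hmem
    rw [h (Ioo_subset_Icc_self hmem)] at hx
    refine ⟨x, mu, hx, hd.congr_of_eventuallyEq ?_⟩
    filter_upwards [Ioo_mem_nhds hmem.1 hmem.2] with ξ hξ using (h (Ioo_subset_Icc_self hξ)).symm

theorem IsTrajectoryOn.glue (hf : N.IsTrajectoryOn f a b) (hg : N.IsTrajectoryOn g b c)
    (hfg : f b = g b) (hab : a ≤ b) (hbc : b ≤ c) :
    N.IsTrajectoryOn (fun θ => if θ ≤ b then f θ else g θ) a c := by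
  have h1 : ∀ θ, θ ≤ b → (if θ ≤ b then f θ else g θ) = f θ := fun θ h => if_pos h
  have h2 : ∀ θ, b ≤ θ → (if θ ≤ b then f θ else g θ) = g θ := by
    intro θ h
    rcases h.eq_or_lt with rfl | h
    · rw [if_pos le_rfl, hfg]
    · exact if_neg (not_le.2 h)
  refine ⟨fun θ hθ => ?_, ?_, ?_⟩
  · rcases le_total θ b with h | h
    · rw [h1 θ h]
      exact hf.feasible θ ⟨hθ.1, h⟩
    · rw [h2 θ h]
      exact hg.feasible θ ⟨h, hθ.2⟩
  · have key : ∀ θ ∈ Icc a c, ∀ ξ ∈ Icc a c, θ ≤ ξ →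
        ‖(if θ ≤ b then f θ else g θ) - (if ξ ≤ b then f ξ else g ξ)‖ ≤ N.maxSpeed * |θ - ξ| := by
      intro θ hθ ξ hξ hle
      rcases le_total θ b with h | h
      · rcases le_total ξ b with h' | h'
        · rw [h1 θ h, h1 ξ h']
          exact hf.norm_sub_le ⟨hθ.1, h⟩ ⟨hξ.1, h'⟩
        · rw [h1 θ h, h2 ξ h']
          have h3 := hf.norm_sub_le (θ := θ) (ξ := b) ⟨hθ.1, h⟩ ⟨hab, le_rfl⟩
          have h4 := hg.norm_sub_le (θ := b) (ξ := ξ) ⟨le_rfl, hbc⟩ ⟨h', hξ.2⟩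
          rw [abs_of_nonpos (sub_nonpos.2 h)] at h3
          rw [abs_of_nonpos (sub_nonpos.2 h')] at h4
          rw [abs_of_nonpos (sub_nonpos.2 hle)]
          have h5 : f θ - g ξ = (f θ - f b) + (g b - g ξ) := by rw [hfg]; abel
          rw [h5]
          refine (norm_add_le _ _).trans ((add_le_add h3 h4).trans (le_of_eq ?_))
          ring
      · rw [h2 θ h, h2 ξ (h.trans hle)]
        exact hg.norm_sub_le ⟨h, hθ.2⟩ ⟨h.trans hle, hξ.2⟩
    refine LipschitzOnWith.of_dist_le_mul fun θ hθ ξ hξ => ?_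
    rcases le_total θ ξ with h | h
    · rw [dist_eq_norm, Real.dist_eq]
      exact key θ hθ ξ hξ h
    · rw [dist_comm, dist_comm θ, dist_eq_norm, Real.dist_eq]
      exact key ξ hξ θ hθ h
  · have hne : ∀ᵐ θ : ℝ, θ ≠ b := by
      simpa using (countable_singleton b).ae_notMem volume
    filter_upwards [hf.thinFlow, hg.thinFlow, hne] with θ hθf hθg hθ hmem
    rcases lt_or_gt_of_ne hθ with h | h
    · obtain ⟨x, mu, hx, hd⟩ := hθf ⟨hmem.1, h⟩
      refine ⟨x, mu, by rwa [h1 θ h.le], hd.congr_of_eventuallyEq ?_⟩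
      filter_upwards [Iio_mem_nhds h] with ξ hξ using h1 ξ (le_of_lt hξ)
    · obtain ⟨x, mu, hx, hd⟩ := hθg ⟨h, hmem.2⟩
      refine ⟨x, mu, by rwa [h2 θ h.le], hd.congr_of_eventuallyEq ?_⟩
      filter_upwards [Ioi_mem_nhds h] with ξ hξ using h2 ξ (le_of_lt hξ)

theorem exists_short_time_estimate {l₀ : V → ℝ} (hl₀ : l₀ ∈ N.feasibleLabellings) :
    ∃ (lam : V → ℝ) (C : ℝ), 0 ≤ C ∧ ∃ ε > 0, ∀ (f : ℝ → V → ℝ) (a b : ℝ),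
      N.IsTrajectoryOn f a b → b ≤ a + ε → ‖f a - l₀‖ ≤ ε → ∀ θ ∈ Icc a b,
      ‖f θ - f a - (θ - a) • lam‖ ≤ C * ‖f a - l₀‖ := by
  obtain ⟨x, lam, hx⟩ := exists_isThinFlow hl₀
  obtain ⟨C, hC, hest⟩ := exists_local_estimate hl₀ hx
  obtain ⟨ρ, hρ, hnear⟩ := N.exists_config_near l₀
  have hK0 := N.maxSpeed.coe_nonneg
  refine ⟨lam, C, hC, ρ / (2 * (N.maxSpeed + 1)), by positivity, fun f a b hf hb hfa θ hθ => ?_⟩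
  refine hest f a θ hθ.1 (hf.mono le_rfl hθ.2) fun ξ hξ => hnear _ ?_
  have h1 := hf.norm_sub_le (θ := ξ) (ξ := a) ⟨hξ.1.le, hξ.2.le.trans hθ.2⟩
    ⟨le_rfl, hθ.1.trans hθ.2⟩
  rw [abs_of_nonneg (sub_nonneg.2 hξ.1.le)] at h1
  have h2 : ξ - a ≤ ρ / (2 * (N.maxSpeed + 1)) := by linarith [hξ.2, hθ.2]
  have h3 : ‖f ξ - l₀‖ ≤ ‖f ξ - f a‖ + ‖f a - l₀‖ := norm_sub_le_norm_sub_add_norm_sub _ _ _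
  have h4 : (N.maxSpeed : ℝ) * (ξ - a) ≤ N.maxSpeed * (ρ / (2 * (N.maxSpeed + 1))) :=
    mul_le_mul_of_nonneg_left h2 hK0
  have h5 : (N.maxSpeed : ℝ) * (ρ / (2 * (N.maxSpeed + 1))) + ρ / (2 * (N.maxSpeed + 1)) = ρ / 2 := by
    field_simp
  linarith

/-- Trajectories depend continuously on the initial value on compact time intervals. -/
theorem IsTrajectoryOn.continuous_dependence {T : ℝ} (hf : N.IsTrajectoryOn f 0 T) (hT : 0 ≤ T)
    {ε : ℝ} (hε : 0 < ε) : ∃ δ > 0, ∀ g, N.IsTrajectoryOn g 0 T → ‖g 0 - f 0‖ < δ →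
      ∀ θ ∈ Icc 0 T, ‖g θ - f θ‖ ≤ ε := by
  have hK0 := N.maxSpeed.coe_nonneg
  suffices H : ∀ t, 0 ≤ t → (t ≤ T → ∀ ε > 0, ∃ δ > 0, ∀ g, N.IsTrajectoryOn g 0 T →
      ‖g 0 - f 0‖ < δ → ∀ θ ∈ Icc 0 t, ‖g θ - f θ‖ ≤ ε) from H T hT le_rfl ε hε
  refine real_induction ?_ ?_ ?_
  · refine fun _ ε hε => ⟨ε, hε, fun g _ hg θ hθ => ?_⟩
    rw [le_antisymm hθ.2 hθ.1]
    exact hg.le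
  · intro t ht ih htT ε hε
    -- Stop `η` before the limit time: both trajectories move by at most `ε / 4` in the remaining
    -- time.
    let η := min t (ε / (4 * (N.maxSpeed + 1)))
    have hη : 0 < η := lt_min ht (by positivity)
    have hηt : η ≤ t := min_le_left _ _
    have hη' : 4 * ((N.maxSpeed + 1) * η) ≤ ε := by
      have := min_le_right t (ε / (4 * (N.maxSpeed + 1)))
      rw [le_div_iff₀ (by positivity)] at this
      linarith
    obtain ⟨δ, hδ, h⟩ := ih (t - η) (by linarith) (by linarith) (by linarith) (ε / 2) (by linarith)
    refine ⟨δ, hδ, fun g hg hg0 θ hθ => ?_⟩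
    rcases le_total θ (t - η) with hle | hle
    · linarith [h g hg hg0 θ ⟨hθ.1, hle⟩]
    · have hm : t - η ∈ Icc 0 T := ⟨by linarith, by linarith⟩
      have hθ' : θ ∈ Icc 0 T := ⟨hθ.1, hθ.2.trans htT⟩
      have h1 := hg.norm_sub_le hθ' hm
      have h2 := hf.norm_sub_le hm hθ'
      have h3 := h g hg hg0 (t - η) ⟨by linarith, le_rfl⟩
      rw [abs_of_nonneg (sub_nonneg.2 hle)] at h1
      rw [abs_of_nonpos (by linarith)] at h2
      have h4 : g θ - f θ = (g θ - g (t - η)) + (g (t - η) - f (t - η)) + (f (t - η) - f θ) := by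
        abel
      have h5 : (N.maxSpeed : ℝ) * (θ - (t - η)) ≤ (N.maxSpeed + 1) * η :=
        mul_le_mul (by linarith) (by linarith [hθ.2]) (by linarith) (by linarith)
      rw [h4]
      refine norm_add₃_le.trans ?_
      linarith
  · intro t ht ih
    by_cases htT : t < T
    swap
    · refine ⟨1, one_pos, fun t' h1 _ h2 => ?_⟩
      obtain rfl : t' = t := le_antisymm (h2.trans (not_lt.1 htT)) h1
      exact ih h2
    obtain ⟨lam, C, hC, ε₀, hε₀, hest⟩ := exists_short_time_estimate
      (hf.feasible t ⟨ht, htT.le⟩)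
    refine ⟨ε₀, hε₀, fun t' htt' ht'ε ht'T ε hε => ?_⟩
    obtain ⟨δ, hδ, h⟩ := ih htT.le (min ε₀ (ε / (C + 1))) (lt_min hε₀ (by positivity))
    refine ⟨δ, hδ, fun g hg hg0 θ hθ => ?_⟩
    have h6 : ‖g t - f t‖ ≤ min ε₀ (ε / (C + 1)) := h g hg hg0 t ⟨ht, le_rfl⟩
    have h7 := h6.trans (min_le_right _ _)
    rw [le_div_iff₀ (by positivity)] at h7
    rcases le_total θ t with hle | hle
    · refine (h g hg hg0 θ ⟨hθ.1, hle⟩).trans ((min_le_right _ _).trans ?_)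
      exact div_le_self hε.le (by linarith)
    · have h1 := hest g t t' (hg.mono ht ht'T) ht'ε (h6.trans (min_le_left _ _)) θ ⟨hle, hθ.2⟩
      -- The estimate is centred at `f t`, so for `f` itself the deviation is zero: `f` is exactly
      -- linear here.
      have h2 := hest f t t' (hf.mono ht ht'T) ht'ε (by simpa using hε₀.le) θ ⟨hle, hθ.2⟩
      rw [sub_self, norm_zero, mul_zero, norm_le_zero_iff] at h2
      have h3 : g θ - f θ = (g θ - g t - (θ - t) • lam) + (g t - f t) -
          (f θ - f t - (θ - t) • lam) := by abel
      rw [h3, h2, sub_zero]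
      refine (norm_add_le _ _).trans ?_
      linarith

theorem IsTrajectoryOn.eqOn {T : ℝ} (hT : 0 ≤ T) (hf : N.IsTrajectoryOn f 0 T)
    (hg : N.IsTrajectoryOn g 0 T) (h0 : g 0 = f 0) : EqOn g f (Icc 0 T) := by
  intro θ hθ
  rw [← sub_eq_zero, ← norm_le_zero_iff]
  refine le_of_forall_pos_le_add fun ε hε => ?_
  obtain ⟨δ, hδ, h⟩ := hf.continuous_dependence hT hε
  rw [zero_add]
  exact h g hg (by simpa [h0] using hδ) θ hθ

theorem exists_isTrajectoryOn {l₀ : V → ℝ} (hl₀ : l₀ ∈ N.feasibleLabellings) :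
    ∀ T, 0 ≤ T → ∃ f, N.IsTrajectoryOn f 0 T ∧ f 0 = l₀ := by
  have hlocal : ∀ (T : ℝ) (f : ℝ → V → ℝ), 0 ≤ T → N.IsTrajectoryOn f 0 T → f 0 = l₀ →
      ∃ ε > 0, ∃ g, N.IsTrajectoryOn g 0 (T + ε) ∧ g 0 = l₀ := by
    intro T f hT hf h0
    obtain ⟨lam, ε, hε, h⟩ := exists_linear_trajectory (hf.feasible T ⟨hT, le_rfl⟩)
    exact ⟨ε, hε, _, hf.glue (h T) (by simp) hT (by linarith), by simp [hT, h0]⟩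
  refine real_induction ⟨fun _ => l₀, ⟨fun _ _ => hl₀, ?_, ?_⟩, rfl⟩ ?_ ?_
  · exact (LipschitzWith.const' l₀).lipschitzOnWith
  · exact Eventually.of_forall fun θ hθ => absurd (hθ.1.trans hθ.2) (lt_irrefl _)
  · intro T hT ih
    choose! F hF hF0 using ih
    have heq : ∀ s t, 0 ≤ s → s ≤ t → t < T → EqOn (F t) (F s) (Icc 0 s) := by
      intro s t hs hst htT
      exact (hF s hs (hst.trans_lt htT)).eqOn hs ((hF t (hs.trans hst) htT).mono le_rfl hst)
        (by rw [hF0 s hs (hst.trans_lt htT), hF0 t (hs.trans hst) htT])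
    have hlip : LipschitzOnWith N.maxSpeed (fun θ => F θ θ) (Ico 0 T) := by
      have key : ∀ θ ∈ Ico 0 T, ∀ ξ ∈ Ico 0 T, θ ≤ ξ →
          ‖F θ θ - F ξ ξ‖ ≤ N.maxSpeed * |θ - ξ| := by
        intro θ hθ ξ hξ hle
        rw [← heq θ ξ hθ.1 hle hξ.2 ⟨hθ.1, le_rfl⟩]
        exact (hF ξ hξ.1 hξ.2).norm_sub_le ⟨hθ.1, hle⟩ ⟨hξ.1, le_rfl⟩
      refine LipschitzOnWith.of_dist_le_mul fun θ hθ ξ hξ => ?_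
      rcases le_total θ ξ with h | h
      · rw [dist_eq_norm, Real.dist_eq]
        exact key θ hθ ξ hξ h
      · rw [dist_comm, dist_comm θ, dist_eq_norm, Real.dist_eq]
        exact key ξ hξ θ hθ h
    -- By uniqueness the partial trajectories agree, and the common speed bound extends their union
    -- to the limit time; closedness keeps the endpoint feasible.
    obtain ⟨g, hg, hgF⟩ := hlip.extend_pi
    have hg0 : g 0 = l₀ := by
      rw [← hgF ⟨le_rfl, hT⟩]
      exact hF0 0 le_rfl hT
    have hgt : ∀ t, 0 ≤ t → t < T → N.IsTrajectoryOn g 0 t := by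
      intro t ht htT
      refine (hF t ht htT).congr fun θ hθ => ?_
      rw [← hgF ⟨hθ.1, hθ.2.trans_lt htT⟩]
      exact heq θ t hθ.1 hθ.2 htT ⟨hθ.1, le_rfl⟩
    have hfeas : ∀ θ ∈ Ico 0 T, g θ ∈ N.feasibleLabellings := fun θ hθ =>
      (hgt θ hθ.1 hθ.2).feasible θ ⟨hθ.1, le_rfl⟩
    refine ⟨g, ⟨fun θ hθ => ?_, hg.lipschitzOnWith, ?_⟩, hg0⟩
    · have h1 : θ ∈ closure (Ico 0 T) := by rwa [closure_Ico hT.ne]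
      exact N.isClosed_feasibleLabellings.closure_subset
        (MapsTo.closure (s := Ico 0 T) hfeas hg.continuous h1)
    · have h1 : ∀ᵐ θ : ℝ, ∀ n : ℕ, θ ∈ Ioo 0 (T - T / (n + 1)) → ∃ x lam,
          N.IsThinFlow (N.activeArcs (g θ)) (N.resettingArcs (g θ)) x lam ∧
            HasDerivAt g lam θ := by
        rw [ae_all_iff]
        intro n
        have h2 : T / (n + 1) ≤ T := div_le_self hT.le (by linarith [n.cast_nonneg (α := ℝ)])
        exact (hgt _ (sub_nonneg.2 h2) (sub_lt_self _ (by positivity))).thinFlow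
      filter_upwards [h1] with θ hθ hmem
      have h3 : Tendsto (fun n : ℕ => T - T / (n + 1)) atTop (𝓝 T) := by
        have := (tendsto_one_div_add_atTop_nhds_zero_nat (𝕜 := ℝ)).const_mul T
        simpa [div_eq_mul_inv] using tendsto_const_nhds (x := T).sub this
      obtain ⟨n, hn⟩ := (h3.eventually_const_lt hmem.2).exists
      exact hθ n ⟨hmem.1, hn⟩
  · rintro T hT ⟨f, hf, h0⟩
    obtain ⟨ε, hε, g, hg, hg0⟩ := hlocal T f hT hf h0
    exact ⟨ε, hε, fun t _ ht => ⟨g, hg.mono le_rfl ht, hg0⟩⟩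

theorem exists_global_trajectory {l₀ : V → ℝ} (hl₀ : l₀ ∈ N.feasibleLabellings) :
    ∃ f : ℝ → V → ℝ, f 0 = l₀ ∧ ∀ T, 0 ≤ T → N.IsTrajectoryOn f 0 T := by
  choose! F hF hF0 using exists_isTrajectoryOn hl₀
  refine ⟨fun θ => F θ θ, hF0 0 le_rfl, fun T hT => (hF T hT).congr fun θ hθ => ?_⟩
  exact (hF θ hθ.1).eqOn hθ.1 ((hF T hT).mono le_rfl hθ.2)
    (by rw [hF0 θ hθ.1, hF0 T hT]) ⟨hθ.1, le_rfl⟩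

end Existence

end FlowNetwork

namespace FlowNetwork

/-! ### Steady states and uniformity in time -/

section LongTerm

open MeasureTheory Set Filter Topology

variable {V E : Type*} [Fintype V] [DecidableEq V] [Fintype E] {N : FlowNetwork V E}
  {f : ℝ → V → ℝ}

/-- Every trajectory reaches a steady state: from some time on, moving along the current label
derivative does not shrink any slack. -/
theorem exists_steady_time (hf : ∀ T, 0 ≤ T → N.IsTrajectoryOn f 0 T) :
    ∃ (T : ℝ) (x : E → ℝ) (lam : V → ℝ), 0 ≤ T ∧
      N.IsThinFlow (N.activeArcs (f T)) (N.resettingArcs (f T)) x lam ∧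
      (∀ e, 0 < N.arcSlack e (f T) → lam (N.src e) ≤ lam (N.tgt e)) ∧
      ∀ e, N.arcSlack e (f T) < 0 → lam (N.tgt e) ≤ lam (N.src e) := by
  have hfeas : ∀ θ, 0 ≤ θ → f θ ∈ N.feasibleLabellings := fun θ hθ =>
    (hf θ hθ).feasible θ ⟨hθ, le_rfl⟩
  -- With all arcs as `P` and none as `Q`, every configuration is admissible, so the growth estimate
  -- holds along the whole trajectory.
  obtain ⟨y, lam, hy⟩ := exists_isComplementary_univ (hfeas 0 le_rfl)
  obtain ⟨α, β, c, hα, hβ, -, -, hc, hrate⟩ := exists_lyapunov hy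
    (hy.pos fun _ he => he.elim)
  have hbound : ∀ a b (c' : ℝ) (lam' : V → ℝ), 0 ≤ a → a ≤ b → 0 ≤ c' →
      (∀ θ ∈ Ioo a b, ∀ x mu,
        N.IsThinFlow (N.activeArcs (f θ)) (N.resettingArcs (f θ)) x mu →
        c' * ‖mu - lam'‖ ≤ c * ‖mu - lam‖) →
      c' * ‖f b - f a - (b - a) • lam'‖ ≤ -N.lyapunov α β (f a) := by
    intro a b c' lam' ha hab hc' h
    have h1 := ((hf b (ha.trans hab)).mono ha le_rfl).deviation_le hab (α := α) (β := β)
      (lam := lam') hc' fun θ hθ x mu hx htight => (h θ hθ x mu hx).trans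
        (hrate _ _ x mu (isFeasibleConfig_of_mem (hfeas θ (ha.trans hθ.1.le))) hx
          (empty_subset _) (subset_univ _) htight)
    linarith [N.lyapunov_nonpos hα hβ (f b)]
  -- After time `r⁻¹` the drift of a slack in direction `lam` outweighs its initial size and the
  -- bounded deviation, so its sign is that of the drift.
  obtain ⟨r, hr, hslack⟩ := exists_pos_mul_le
    (ι := {e : E // lam (N.tgt e) - lam (N.src e) ≠ 0})
    (fun e => |lam (N.tgt e) - lam (N.src e)|)
    (fun e => |N.arcSlack e (f 0)| + 2 * (-N.lyapunov α β (f 0) / c) + 1)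
    (fun e => abs_pos.2 e.2)
  have hsign : ∀ T, r⁻¹ ≤ T → ∀ e, (0 < N.arcSlack e (f T) → lam (N.src e) ≤ lam (N.tgt e)) ∧
      (N.arcSlack e (f T) < 0 → lam (N.tgt e) ≤ lam (N.src e)) := by
    intro T hT e
    by_cases hd : lam (N.tgt e) - lam (N.src e) = 0
    · rw [sub_eq_zero] at hd
      exact ⟨fun _ => hd.ge, fun _ => hd.le⟩
    have hT0 : 0 < T := (inv_pos.2 hr).trans_le hT
    have h1 := hslack ⟨e, hd⟩
    have h2 := hbound 0 T c lam le_rfl hT0.le hc.le fun _ _ _ _ _ => le_rfl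
    rw [← le_div_iff₀' hc, sub_sub, sub_zero] at h2
    have h3 := abs_arcSlack_sub_le (N := N) e (f T) (f 0 + T • lam)
    rw [arcSlack_add_smul] at h3
    replace h3 := abs_le.1 (h3.trans (mul_le_mul_of_nonneg_left h2 zero_le_two))
    have h4 : |N.arcSlack e (f 0)| + 2 * (-N.lyapunov α β (f 0) / c) + 1 ≤
        T * |lam (N.tgt e) - lam (N.src e)| := by
      refine ((le_div_iff₀' hr).2 h1).trans ?_
      rw [div_eq_inv_mul]
      exact mul_le_mul_of_nonneg_right hT (abs_nonneg _)
    have h5 := abs_le.1 (le_refl |N.arcSlack e (f 0)|)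
    rcases lt_or_gt_of_ne hd with h | h
    · rw [abs_of_neg h] at h4
      exact ⟨fun h6 => by linarith [h3.2, h5.2], fun _ => by linarith⟩
    · rw [abs_of_pos h] at h4
      exact ⟨fun _ => by linarith, fun h6 => by linarith [h3.1, h5.1]⟩
  suffices H : ∃ T ≥ r⁻¹, ∃ x,
      N.IsThinFlow (N.activeArcs (f T)) (N.resettingArcs (f T)) x lam by
    obtain ⟨T, hT, x, hx⟩ := H
    exact ⟨T, x, lam, (inv_pos.2 hr).le.trans hT, hx, fun e => (hsign T hT e).1,
      fun e => (hsign T hT e).2⟩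
  by_contra! hcon
  have : Finite {p : (Set E × Set E) × (V → ℝ) // N.IsFeasibleConfig p.1.1 p.1.2 ∧
    ∃ x, N.IsThinFlow p.1.1 p.1.2 x p.2} := N.finite_thinFlows.to_subtype
  obtain ⟨κ, hκ, hgap⟩ := exists_pos_mul_le
    (ι := {p : {p : (Set E × Set E) × (V → ℝ) // N.IsFeasibleConfig p.1.1 p.1.2 ∧
      ∃ x, N.IsThinFlow p.1.1 p.1.2 x p.2} // p.1.2 - lam ≠ 0})
    (fun p => ‖p.1.1.2 - lam‖) (fun _ => 1) (fun p => norm_pos_iff.2 p.2)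
  have ha : 0 ≤ r⁻¹ := (inv_pos.2 hr).le
  set a := r⁻¹
  -- If no derivative after time `a` equals `lam`, all stay at distance at least `κ = ‖w‖`. Then
  -- `‖mu - (lam + w)‖ ≤ 2 ‖mu - lam‖`, so the displacement is boundedly close to both directions
  -- `lam` and `lam + w`, which is impossible over the length `L`.
  set w : V → ℝ := fun _ => κ
  have hw : ‖w‖ = κ := by
    have : Nonempty V := ⟨N.s⟩
    rw [pi_norm_const, Real.norm_of_nonneg hκ.le]
  set M := -N.lyapunov α β (f a)
  have hM : 0 ≤ M := neg_nonneg.2 (N.lyapunov_nonpos hα hβ _)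
  set L := 4 * (M / (c * κ)) + 1
  have hL : 0 ≤ L := by positivity
  have h1 := hbound a (a + L) (c / 2) lam ha (by linarith) (by positivity) fun θ _ x mu _ =>
    mul_le_mul_of_nonneg_right (by linarith) (norm_nonneg _)
  have h2 := hbound a (a + L) (c / 2) (lam + w) ha (by linarith) (by positivity)
    fun θ hθ x mu hx => by
      have hne : mu - lam ≠ 0 := by
        rw [sub_ne_zero]
        rintro rfl
        exact hcon θ hθ.1.le x hx
      have h3 := hgap ⟨⟨((_, _), mu),
        isFeasibleConfig_of_mem (hfeas θ (ha.trans hθ.1.le)), x, hx⟩, hne⟩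
      have h4 : ‖mu - (lam + w)‖ ≤ ‖mu - lam‖ + ‖w‖ := by
        rw [← sub_sub]
        exact norm_sub_le _ _
      have h5 : ‖mu - (lam + w)‖ ≤ 2 * ‖mu - lam‖ := by simp only at h3; linarith
      calc c / 2 * ‖mu - (lam + w)‖ ≤ c / 2 * (2 * ‖mu - lam‖) :=
            mul_le_mul_of_nonneg_left h5 (by positivity)
        _ = c * ‖mu - lam‖ := by ring
  have h3 : ‖L • w‖ ≤ ‖f (a + L) - f a - (a + L - a) • lam‖ +
      ‖f (a + L) - f a - (a + L - a) • (lam + w)‖ := by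
    have : L • w = (f (a + L) - f a - (a + L - a) • lam) -
        (f (a + L) - f a - (a + L - a) • (lam + w)) := by
      rw [add_sub_cancel_left, smul_add]
      abel
    rw [this]
    exact norm_sub_le _ _
  rw [norm_smul, Real.norm_of_nonneg hL, hw] at h3
  have h4 : c / 2 * (L * κ) ≤ 2 * M := by
    have := mul_le_mul_of_nonneg_left h3 (half_pos hc).le
    linarith
  have h5 : c / 2 * (L * κ) = 2 * M + c / 2 * κ := by
    simp only [L]
    field_simp
    ring
  have h6 : 0 < c / 2 * κ := by positivity
  linarith

/-- Trajectories depend continuously on the initial value, uniformly for all times. -/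
theorem uniform_continuous_dependence (hf : ∀ T, 0 ≤ T → N.IsTrajectoryOn f 0 T) {ε : ℝ}
    (hε : 0 < ε) : ∃ δ > 0, ∀ g, (∀ T, 0 ≤ T → N.IsTrajectoryOn g 0 T) → ‖g 0 - f 0‖ < δ →
      ∀ θ, 0 ≤ θ → ‖g θ - f θ‖ ≤ ε := by
  obtain ⟨T, x, lam, hT, hx, hpos, hneg⟩ := exists_steady_time hf
  have hmem := (hf T hT).feasible T ⟨hT, le_rfl⟩
  obtain ⟨C, hC, hest⟩ := exists_local_estimate hmem hx
  obtain ⟨ρ, hρ, hstable⟩ := N.exists_config_stable (f T)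
  have hlinear : ∀ g, (∀ T, 0 ≤ T → N.IsTrajectoryOn g 0 T) → (C + 1) * ‖g T - f T‖ < ρ →
      ∀ t, T ≤ t → ‖g t - g T - (t - T) • lam‖ ≤ C * ‖g T - f T‖ := by
    intro g hg hgT
    have hsub : ∀ t, T ≤ t → ‖g t - g T - (t - T) • lam‖ ≤ C * ‖g T - f T‖ →
        N.resettingArcs (f T) ⊆ N.resettingArcs (g t) ∧
          N.activeArcs (g t) ⊆ N.activeArcs (f T) := by
      intro t ht h
      refine hstable lam (t - T) (g t) (sub_nonneg.2 ht) hpos hneg ?_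
      have h1 : g t - (f T + (t - T) • lam) =
          (g t - g T - (t - T) • lam) + (g T - f T) := by abel
      rw [h1]
      refine (norm_add_le _ _).trans_lt ?_
      linarith
    -- A bootstrap: the inclusions make the local estimate available, and in a steady state the
    -- estimate returns the inclusions however much time has passed. They are open, so they persist
    -- beyond each time.
    have H : ∀ t, 0 ≤ t → ∀ θ ∈ Icc T (T + t), N.resettingArcs (f T) ⊆ N.resettingArcs (g θ) ∧
        N.activeArcs (g θ) ⊆ N.activeArcs (f T) := by
      refine real_induction ?_ ?_ ?_
      · intro θ hθ
        rw [add_zero, Icc_self] at hθ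
        obtain rfl : θ = T := hθ
        exact hsub _ le_rfl (by simpa using by positivity)
      · intro t ht ih θ hθ
        refine hsub θ hθ.1 (hest g T θ hθ.1 ((hg θ (hT.trans hθ.1)).mono hT le_rfl)
          fun ξ hξ => ih (ξ - T) (by linarith [hξ.1]) (by linarith [hξ.2, hθ.2]) ξ ?_)
        exact ⟨hξ.1.le, by linarith⟩
      · intro t ht ih
        have hcw : ContinuousWithinAt g (Icc 0 (T + t + 1)) (T + t) :=
          (hg (T + t + 1) (by linarith)).lipschitz.continuousOn _ ⟨by linarith, by linarith⟩
        have hopen := hcw ((N.isOpen_config_subset (N.resettingArcs (f T))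
          (N.activeArcs (f T))).mem_nhds (ih (T + t) ⟨by linarith, le_rfl⟩))
        obtain ⟨η, hη, hball⟩ := Metric.mem_nhdsWithin_iff.1 hopen
        refine ⟨min (η / 2) 1, by positivity, fun t' htt' ht' θ hθ => ?_⟩
        have h1 := min_le_left (η / 2) 1
        have h2 := min_le_right (η / 2) 1
        rcases le_total θ (T + t) with hle | hle
        · exact ih θ ⟨hθ.1, hle⟩
        · refine hball ⟨?_, ?_, ?_⟩
          · rw [Metric.mem_ball, Real.dist_eq, abs_of_nonneg (by linarith)]
            linarith [hθ.2]
          · linarith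
          · linarith [hθ.2]
    intro t ht
    exact hest g T t ht ((hg t (hT.trans ht)).mono hT le_rfl) fun ξ hξ =>
      H (ξ - T) (by linarith [hξ.1]) ξ ⟨hξ.1.le, by linarith⟩
  -- The factor `C + 1` covers the distance at time `T` plus the later deviation; half of `ρ` makes
  -- the stability bound strict.
  have hρ' : 0 < min ε (ρ / 2) / (C + 1) := by positivity
  obtain ⟨δ, hδ, h⟩ := (hf T hT).continuous_dependence hT hρ'
  refine ⟨δ, hδ, fun g hg hg0 θ hθ => ?_⟩
  rcases le_total θ T with hle | hle
  · refine (h g (hg T hT) hg0 θ ⟨hθ, hle⟩).trans ?_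
    exact (div_le_self (by positivity) (by linarith)).trans (min_le_left _ _)
  · have h1 := h g (hg T hT) hg0 T ⟨hT, le_rfl⟩
    rw [le_div_iff₀' (by positivity)] at h1
    have h2 := min_le_left ε (ρ / 2)
    have h3 := min_le_right ε (ρ / 2)
    have h4 := hlinear g hg (by linarith) θ hle
    have h5 := hlinear f hf (by simpa using hρ) θ hle
    rw [sub_self, norm_zero, mul_zero, norm_le_zero_iff] at h5
    have h6 : g θ - f θ = (g θ - g T - (θ - T) • lam) + (g T - f T) -
        (f θ - f T - (θ - T) • lam) := by abel
    rw [h6, h5, sub_zero]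
    refine (norm_add_le _ _).trans ?_
    linarith

/-- Absolute continuity upgrades to the common Lipschitz bound; conversely, countably many bounded
intervals exhaust the half-line up to a null set. -/
theorem isEquilibriumTrajectory_iff {l : ℝ≥0 → V → ℝ} : N.IsEquilibriumTrajectory l ↔
    ∀ T, 0 ≤ T → N.IsTrajectoryOn (fun θ => l θ.toNNReal) 0 T := by
  constructor
  · intro h T hT
    refine isTrajectoryOn_of_absolutelyContinuous (fun θ _ => h.feasible _) ?_ ?_
    · exact h.absCont ⟨T, hT⟩
    · filter_upwards [(ae_restrict_iff' measurableSet_Ioi).1 h.thinFlow] with θ hθ hmem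
        using hθ hmem.1
  · intro h
    refine ⟨fun θ => ?_, fun T => (h T T.2).absolutelyContinuousOnInterval T.2, ?_⟩
    · simpa using (h θ θ.2).feasible θ ⟨θ.2, le_rfl⟩
    · rw [ae_restrict_iff' measurableSet_Ioi]
      have h1 : ∀ᵐ θ : ℝ, ∀ n : ℕ, θ ∈ Ioo (0 : ℝ) n → ∃ x lam,
          N.IsThinFlow (N.activeArcs (l θ.toNNReal)) (N.resettingArcs (l θ.toNNReal)) x lam ∧
            HasDerivAt (fun ξ : ℝ => l ξ.toNNReal) lam θ :=
        ae_all_iff.2 fun n => (h n n.cast_nonneg).thinFlow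
      filter_upwards [h1] with θ hθ hpos
      obtain ⟨n, hn⟩ := exists_nat_gt θ
      exact hθ n ⟨hpos, hn⟩

end LongTerm

end FlowNetwork

/-! ### The main theorem -/

theorem mainTheorem2 {V E : Type*} [Fintype V] [DecidableEq V] [Fintype E]
    (N : FlowNetwork V E) :
    ∃ Ψ : N.feasibleLabellings → (ℝ≥0 → V → ℝ),
      (∀ (l₀ : N.feasibleLabellings) (l : ℝ≥0 → V → ℝ),
        (N.IsEquilibriumTrajectory l ∧ l 0 = l₀) ↔ l = Ψ l₀) ∧
      (∃ K : ℝ≥0, ∀ l₀, LipschitzWith K (Ψ l₀)) ∧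
      (∀ ξ : ℝ≥0, Continuous fun l₀ => Ψ l₀ ξ) ∧
      Continuous fun l₀ => UniformFun.ofFun (Ψ l₀) := by
  choose F hF0 hF using fun l₀ : N.feasibleLabellings =>
    FlowNetwork.exists_global_trajectory l₀.2
  have huniform : ∀ (l₀ : N.feasibleLabellings) (ε : ℝ), 0 < ε → ∃ δ > 0,
      ∀ m₀, dist m₀ l₀ < δ → ∀ ξ : ℝ≥0, dist (F l₀ ξ) (F m₀ ξ) ≤ ε := by
    intro l₀ ε hε
    obtain ⟨δ, hδ, h⟩ := FlowNetwork.uniform_continuous_dependence (hF l₀) hε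
    refine ⟨δ, hδ, fun m₀ hm ξ => ?_⟩
    rw [dist_comm, dist_eq_norm]
    refine h _ (hF m₀) ?_ ξ ξ.2
    rwa [hF0, hF0, ← dist_eq_norm]
  refine ⟨fun l₀ ξ => F l₀ ξ, fun l₀ l => ?_, ⟨N.maxSpeed, fun l₀ => ?_⟩, fun ξ => ?_, ?_⟩
  · rw [FlowNetwork.isEquilibriumTrajectory_iff]
    constructor
    · rintro ⟨hl, h0⟩
      funext ξ
      have h1 := (hF l₀ ξ ξ.2).eqOn ξ.2 (hl ξ ξ.2) (by simpa [hF0] using h0) ⟨ξ.2, le_rfl⟩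
      simpa using h1
    · rintro rfl
      refine ⟨fun T hT => (hF l₀ T hT).congr fun θ hθ => ?_, by simpa using hF0 l₀⟩
      simp [hθ.1]
  · refine LipschitzWith.of_dist_le_mul fun ξ η => ?_
    have hm : 0 ≤ max (ξ : ℝ) η := le_max_of_le_left ξ.2
    have h1 := (hF l₀ _ hm).lipschitz.dist_le_mul ξ ⟨ξ.2, le_max_left _ _⟩ η
      ⟨η.2, le_max_right _ _⟩
    exact h1
  · refine continuous_iff_continuousAt.2 fun l₀ => Metric.continuousAt_iff.2 fun ε hε => ?_
    obtain ⟨δ, hδ, h⟩ := huniform l₀ (ε / 2) (half_pos hε)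
    refine ⟨δ, hδ, fun m₀ hm => ?_⟩
    rw [dist_comm]
    exact (h m₀ hm ξ).trans_lt (half_lt_self hε)
  · refine continuous_iff_continuousAt.2 fun l₀ => ?_
    rw [ContinuousAt, UniformFun.tendsto_iff_tendstoUniformly, Metric.tendstoUniformly_iff]
    intro ε hε
    obtain ⟨δ, hδ, h⟩ := huniform l₀ (ε / 2) (half_pos hε)
    filter_upwards [Metric.ball_mem_nhds l₀ hδ] with m₀ hm ξ
    exact (h m₀ hm ξ).trans_lt (half_lt_self hε)
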